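/- Let $d\ge 1$, let $T=T(z)=1+zT(z)^{2d+1}$ be the generating function of $(2d+1)$-ary trees counted by internal nodes, let $F$ be a field containing $\mathbb{C}$, put $t=z^{1/d}$, and work in the field $K=F((t))$ of formal Laurent series, so that $z=t^d$. A small root is an $X\in K$ of positive order in $t$ with $$1=zT^{2d}\sum_{\ell=-d}^{d}X^{\ell}.$$ There are exactly $d$ small roots; denote them $X_1,\dots,X_d$, and write $\mathbf{X}^{j\mathbf{n}}=\prod_{\ell=1}^d X_\ell^{jn_\ell}$ for $\mathbf{n}\in\mathbb{N}_0^d$, $j\in\mathbb{Z}$. Let $\mathbf{e}_\ell$ be the $\ell$-th unit vector. For every choice of $a_1,\dots,a_d\in K$ (the free parameters) there is exactly one family $(\alpha_{\mathbf n})_{\mathbf n\in\mathbb{N}_0^d}$ in $K$ such that $\alpha_{\mathbf 0}=0$, $$\alpha_{n\mathbf e_\ell}=\frac{a_\ell^{\,n}X_\ell^{n-1}(1-X_\ell^{nd})}{(1-X_\ell^d)(1-X_\ell)^{n-1}(1-X_\ell^{d+1})^{n-1}}\qquad(1\le\ell\le d,\ n\ge1),$$ and such that for every $\mathbf n$ that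 is not a multiple of a unit vector $$\alpha_{\mathbf n}\Big(-\frac1{zT^{2d}}+\sum_{\ell=-d}^{d}\mathbf X^{\ell\mathbf n}\Big)=\sum_{\ell=2}^{2d+1}(-1)^\ell\sum_{b}\ \sum_{\mathbf g_1+\dots+\mathbf g_\ell=\mathbf n}\ \prod_{k=1}^{\ell}\alpha_{\mathbf g_k}\prod_{k=1}^{\ell}\mathbf X^{b_k\mathbf g_k},\qquad(*)$$ where $b=\{b_1<\dots<b_\ell\}$ runs over the $\ell$-element subsets of $\{-d,\dots,d\}$ and $\mathbf g_k\in\mathbb{N}_0^d\setminus\{\mathbf 0\}$. It satisfies $\alpha_{\mathbf e_\ell}=a_\ell$, and $(*)$ holds for all $\mathbf n\in\mathbb{N}_0^d\setminus\{\mathbf 0,\mathbf e_1,\dots,\mathbf e_d\}$. Put $\rho_j=\sum_{\mathbf n}\alpha_{\mathbf n}\mathbf X^{j\mathbf n}$ and $T_j=T(1-\rho_j)$. Then $$T_j=1+z\prod_{\ell=-d}^{d}T_{j+\ell},\qquad\text{equivalently}\qquad \rho_j=zT^{2d}\sum_{\ell=1}^{2d+1}(-1)^{\ell-1}\sum_{b}\prod_{k=1}^{\ell}\rho_{j+b_k}$$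 ($b=\{b_1,\dots,b_\ell\}$ running over the $\ell$-element subsets of $\{-d,\dots,d\}$), in both of the following senses. (i) Formally, for every $j\in\mathbb{Z}$: the equations hold in $K[[w_1,\dots,w_d]]$ if $\rho_j$ is read as $\sum_{\mathbf n}\alpha_{\mathbf n}\mathbf X^{j\mathbf n}\mathbf w^{\mathbf n}$. (ii) In $K$ with its $t$-adic topology: if $j_0\in\mathbb{Z}$ is such that every $a_\ell X_\ell^{j_0}$ has non-negative order in $t$, then the series $\rho_j$ converges for all $j\ge j_0$, and the equations hold for all $j\ge j_0+d$. Thus the solutions form a family with $d$ free parameters. -/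

import Mathlib

open scoped BigOperators

noncomputable section

/-- Plane trees in which every node is either a leaf (external node) or an internal node
with `m` ordered subtrees. -/
inductive MaryTree (m : ℕ) : Type
  | leaf : MaryTree m
  | node : (Fin m → MaryTree m) → MaryTree m

namespace MaryTree

/-- The size of a tree is its number of internal nodes. -/
def size {m : ℕ} : MaryTree m → ℕ
  | leaf => 0
  | node c => 1 + ∑ i, (c i).size

@[simp] theorem size_leaf {m : ℕ} : (leaf : MaryTree m).size = 0 := by rw [size]

@[simp] theorem size_node {m : ℕ} (c : Fin m → MaryTree m) :
    (node c).size = 1 + ∑ i, (c i).size := by rw [size]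

/-- The number of `m`-ary trees of size `n`. -/
def count (m n : ℕ) : ℕ := Nat.card {t : MaryTree m // t.size = n}

/-- A tree of size `n + 1` is an internal node with subtrees of sizes summing to `n`. -/
def succEquiv (m n : ℕ) : {t : MaryTree m // t.size = n + 1} ≃
    (Σ g : {g : Fin m → ℕ // g ∈ Finset.piAntidiag Finset.univ n},
      ∀ i, {t : MaryTree m // t.size = g.1 i}) where
  toFun t := match t with
    | ⟨leaf, h⟩ => absurd h (by simp [size])
    | ⟨node c, h⟩ => ⟨⟨fun i => (c i).size, by simp [size] at h ⊢; omega⟩, fun i => ⟨c i, rfl⟩⟩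
  invFun s := ⟨node fun i => (s.2 i).1, by
    obtain ⟨⟨g, hg⟩, c⟩ := s
    have h : ∑ i, g i = n := (Finset.mem_piAntidiag.1 hg).1
    simp only [size_node, fun i => (c i).2]
    omega⟩
  left_inv t := by
    obtain ⟨t, h⟩ := t
    cases t with
    | leaf => simp [size] at h
    | node c => rfl
  right_inv s := by
    obtain ⟨⟨g, hg⟩, c⟩ := s
    obtain ⟨u, hu, rfl⟩ : ∃ (u : Fin m → MaryTree m) (hu : ∀ i, (u i).size = g i),
        c = fun i => ⟨u i, hu i⟩ := ⟨fun i => (c i).1, fun i => (c i).2, rfl⟩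
    obtain rfl : (fun i => (u i).size) = g := funext hu
    rfl

theorem finite_size (m n : ℕ) : Finite {t : MaryTree m // t.size = n} := by
  induction n using Nat.strong_induction_on with
  | _ n ih =>
    cases n with
    | zero =>
      refine Finite.of_injective (fun _ => ()) ?_
      rintro ⟨s, hs⟩ ⟨t, ht⟩ -
      cases s with
      | leaf =>
        cases t with
        | leaf => rfl
        | node c => simp at ht
      | node c => simp at hs
    | succ n =>
      have : ∀ g : {g : Fin m → ℕ // g ∈ Finset.piAntidiag Finset.univ n},
          Finite (∀ i, {t : MaryTree m // t.size = g.1 i}) := by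
        rintro ⟨g, hg⟩
        have hg' : ∑ i, g i = n := (Finset.mem_piAntidiag.1 hg).1
        have : ∀ i, Finite {t : MaryTree m // t.size = g i} := fun i =>
          ih _ (by
            have := Finset.single_le_sum (f := g) (fun _ _ => Nat.zero_le _) (Finset.mem_univ i)
            omega)
        infer_instance
      exact Finite.of_equiv _ (succEquiv m n).symm

theorem count_zero (m : ℕ) : count m 0 = 1 := by
  have : Unique {t : MaryTree m // t.size = 0} :=
    { default := ⟨leaf, size_leaf⟩
      uniq := by
        rintro ⟨t, ht⟩
        cases t with
        | leaf => rfl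
        | node c => simp at ht }
  exact Nat.card_unique

theorem count_succ (m n : ℕ) : count m (n + 1) =
    ∑ g ∈ Finset.piAntidiag (Finset.univ : Finset (Fin m)) n, ∏ i, count m (g i) := by
  have := finite_size m
  rw [count, Nat.card_congr (succEquiv m n), Nat.card_sigma,
    ← Finset.sum_coe_sort (Finset.piAntidiag (Finset.univ : Finset (Fin m)) n)
      (fun g => ∏ i, count m (g i))]
  refine Finset.sum_congr rfl fun g _ => ?_
  rw [Nat.card_pi]
  rfl

/-- The generating function `T(z) = ∑ Tₙ zⁿ` of `m`-ary trees counted by size. -/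
def series (R : Type*) [CommSemiring R] (m : ℕ) : PowerSeries R :=
  PowerSeries.mk fun n => (count m n : R)

/-- `T = 1 + z T ^ m`. -/
theorem series_eq (R : Type*) [CommSemiring R] (m : ℕ) :
    series R m = 1 + PowerSeries.X * series R m ^ m := by
  ext n
  cases n with
  | zero => simp [series, count_zero]
  | succ n =>
    have h : series R m ^ m = ∏ _i : Fin m, series R m := by simp
    rw [map_add, PowerSeries.coeff_succ_X_mul, h, PowerSeries.coeff_prod]
    simp only [series, PowerSeries.coeff_mk, count_succ, PowerSeries.coeff_one, Nat.succ_ne_zero,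
      Nat.cast_sum, Nat.cast_prod, if_false, zero_add]
    refine Finset.sum_bij' (fun g _ => Finsupp.equivFunOnFinite.symm g) (fun g _ => ⇑g)
      ?_ ?_ ?_ ?_ ?_ <;> simp [Finset.mem_finsuppAntidiag]

end MaryTree

namespace EmbeddedTrees

/-- The variable `z = t ^ d` in the field `F((t))` of Laurent series in `t = z ^ (1 / d)`. -/
def z (F : Type*) [Field F] (d : ℕ) : LaurentSeries F :=
  HahnSeries.single (d : ℤ) 1

/-- The generating function `T(z)` of `(2 d + 1)`-ary trees at `z = t ^ d`, in `F((t))`. -/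
def T (F : Type*) [Field F] (d : ℕ) [NeZero d] : LaurentSeries F :=
  HahnSeries.ofPowerSeries ℤ F
    (PowerSeries.expand d (NeZero.ne d) (MaryTree.series F (2 * d + 1)))

/-- The small solutions of the characteristic equation `1 = z T ^ (2 d) ∑_{ℓ = -d}^{d} x ^ ℓ`,
that is, those of positive order in `t`. -/
def smallRoots (F : Type*) [Field F] (d : ℕ) [NeZero d] : Set (LaurentSeries F) :=
  {x | 1 = z F d * T F d ^ (2 * d) * ∑ l ∈ Finset.Icc (-(d : ℤ)) d, x ^ l ∧ Valued.v x < 1}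

variable {F : Type*} [Field F] {d : ℕ}

/-- The monomial `X ^ (j n) = ∏_ℓ X_ℓ ^ (j n_ℓ)`, for an integer `j`. -/
def monom (X : Fin d → LaurentSeries F) (j : ℤ) (n : Fin d →₀ ℕ) : LaurentSeries F :=
  ∏ l, X l ^ (j * (n l : ℤ))

/-- The recurrence relation for the coefficient of index `n`:
`α_n (-1 / (z T ^ (2 d)) + ∑_{ℓ = -d}^{d} X ^ (ℓ n))` equals
`∑_{ℓ = 2}^{2 d + 1} (-1) ^ ℓ ∑_b ∑_g ∏_{k ∈ b} α_{g_k} ∏_{k ∈ b} X ^ (k g_k)`, where `b` runs over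
the subsets of `{-d, …, d}` of size `ℓ` and `g` over the families `(g_k)_{k ∈ b}` of nonzero
vectors with sum `n`. (As functions on all of `ℤ`, these `g` vanish outside `b`.) -/
def Recurrence [NeZero d] (X : Fin d → LaurentSeries F) (α : (Fin d →₀ ℕ) → LaurentSeries F)
    (n : Fin d →₀ ℕ) : Prop :=
  α n * (-(1 / (z F d * T F d ^ (2 * d))) + ∑ l ∈ Finset.Icc (-(d : ℤ)) d, monom X l n) =
    ∑ l ∈ Finset.Icc 2 (2 * d + 1), (-1) ^ l *
      ∑ b ∈ Finset.powersetCard l (Finset.Icc (-(d : ℤ)) d),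
        ∑ g ∈ (Finset.piAntidiag b n).filter (fun g => ∀ k ∈ b, g k ≠ 0),
          (∏ k ∈ b, α (g k)) * ∏ k ∈ b, monom X k (g k)

/-- `α` is the coefficient family with initial values `α_{e_ℓ} = a_ℓ`: explicit at `0` and on the
coordinate axes, given by the recurrence relation elsewhere. -/
structure IsCoeffFamily [NeZero d] (X a : Fin d → LaurentSeries F)
    (α : (Fin d →₀ ℕ) → LaurentSeries F) : Prop where
  zero : α 0 = 0
  axis : ∀ (l : Fin d) (n : ℕ), 1 ≤ n → α (Finsupp.single l n) =
    (a l ^ n * X l ^ (n - 1) * (1 - X l ^ (n * d))) /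
      ((1 - X l ^ d) * (1 - X l) ^ (n - 1) * (1 - X l ^ (d + 1)) ^ (n - 1))
  off_axis : ∀ n : Fin d →₀ ℕ, (∀ (l : Fin d) (k : ℕ), n ≠ Finsupp.single l k) →
    Recurrence X α n

/-- `ρ_j` as a formal power series, `∑_n α_n X ^ (j n) w ^ n` over the field `F((t))`. -/
def rhoFormal (X : Fin d → LaurentSeries F) (α : (Fin d →₀ ℕ) → LaurentSeries F) (j : ℤ) :
    MvPowerSeries (Fin d) (LaurentSeries F) :=
  fun n => α n * monom X j n

/-- `ρ_j = ∑_n α_n X ^ (j n)` as an element of `F((t))`, the sum being taken in the `t`-adic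
topology. -/
def rho (X : Fin d → LaurentSeries F) (α : (Fin d →₀ ℕ) → LaurentSeries F) (j : ℤ) :
    LaurentSeries F :=
  ∑' n : Fin d →₀ ℕ, α n * monom X j n

/-- The tree recurrence at `j`: `T_j = 1 + z ∏_{ℓ = -d}^{d} T_{j + ℓ}`. -/
def TreeEquation {A : Type*} [CommRing A] (d : ℕ) (z : A) (T : ℤ → A) (j : ℤ) : Prop :=
  T j = 1 + z * ∏ l ∈ Finset.Icc (-(d : ℤ)) d, T (j + l)

/-- The main equation at `j`, with `Z` in the role of `z T ^ (2 d)`: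
`ρ_j = Z ∑_{ℓ = 1}^{2 d + 1} (-1) ^ (ℓ - 1) ∑_b ∏_{k ∈ b} ρ_{j + k}`, where `b` runs over the
subsets of `{-d, …, d}` of size `ℓ`. -/
def MainEquation {A : Type*} [CommRing A] (d : ℕ) (Z : A) (ρ : ℤ → A) (j : ℤ) : Prop :=
  ρ j = Z * ∑ l ∈ Finset.Icc 1 (2 * d + 1), (-1) ^ (l - 1) *
    ∑ b ∈ Finset.powersetCard l (Finset.Icc (-(d : ℤ)) d), ∏ k ∈ b, ρ (j + k)

end EmbeddedTrees

end

/-!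
Dividing the main equation by `X ^ (j n)` turns its coefficient of `w ^ n` into the recurrence for
`α_n` at `n`, with no reference to `j` (`coeff_mainEquation_iff_recurrence`). So the formal main
equations for all `j` amount to the recurrence at every index, and the tree equations follow by
expanding `∏ (1 - ρ_{j + k})` (`treeEquation_iff_mainEquation`).

The substitution `x = t / u` makes the characteristic equation a monic polynomial equation in `u`
over `F[[t]]`, which modulo `t` reads `u ^ d (u ^ d - 1) = 0`. The small roots correspond
to the unit solutions `u`, and Hensel's lemma puts them in bijection with the `d`-th roots of unity in `F`
(`ncard_smallRoots`). In particular each small root has order exactly one in `t`, so `X ^ n` has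
order `|n|`, and for `|n| ≥ 2` the factor of `α_n` in the recurrence has order `-d |n|`: the term
`X ^ (-d n)` dominates. Hence that factor does not vanish and the recurrence determines `α_n` off
the axes.

On an axis the explicit coefficients sum to `T_j = T f_{j-1} f_{j+d+1} / (f_j f_{j+d})` with
`f_i = 1 - c x ^ i w`. The product of the `T_{j+l}` telescopes, and the tree equation becomes an
identity between quadratic polynomials in `w` whose linear coefficient is the characteristic
equation (`linear_coeff_identity`, `treeEquation_axisFamily`). As the recurrence at a point of an
axis only involves points of that axis, it holds there as well (`IsCoeffFamily.recurrence`).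

For convergence, induction on `|n|` gives `ord α_n ≥ |n| - 1 - j₀ |n|` when `ord a_l ≥ -j₀`
(`IsCoeffFamily.valuation_le`): a product of `ℓ` factors in the recurrence loses `ℓ` from the
summands `-1`, and all but one of these are recovered because the exponents `k + d` with `k ∈ b`
are distinct nonnegative integers. The series `ρ_j` with `j ≥ j₀` therefore converge, and since
summation of all coefficients is multiplicative over a nonarchimedean ring (`hasSum_coeff_mul`),
the formal equations specialize at `w = 1`.
-/

noncomputable section

namespace EmbeddedTrees

open Finset

/-! ### The tree recurrence and the main equation -/

theorem prod_one_sub_eq {A : Type*} [CommRing A] (d : ℕ) (ρ : ℤ → A) :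
    ∏ k ∈ Icc (-(d : ℤ)) d, (1 - ρ k) =
      1 - ∑ l ∈ Icc 1 (2 * d + 1), (-1) ^ (l - 1) *
        ∑ b ∈ powersetCard l (Icc (-(d : ℤ)) d), ∏ k ∈ b, ρ k := by
  have hcard : #(Icc (-(d : ℤ)) d) = 2 * d + 1 := by simp; omega
  have h : ∀ b : Finset ℤ, ∏ k ∈ b, -ρ k = (-1) ^ #b * ∏ k ∈ b, ρ k := fun b => prod_neg ρ
  simp only [sub_eq_add_neg]
  rw [prod_one_add, sum_powerset, hcard, range_eq_Ico,
    ← Finset.sum_Ioo_add_eq_sum_Ico (by omega : 0 < 2 * d + 1 + 1), add_comm,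
    ← sum_neg_distrib]
  congr 1
  · simp
  · refine sum_congr (by ext; simp; omega) fun l hl => ?_
    obtain ⟨l, rfl⟩ : ∃ m, l = m + 1 := ⟨l - 1, by simp at hl; omega⟩
    rw [mul_sum, ← sum_neg_distrib]
    refine sum_congr rfl fun b hb => ?_
    rw [h, (mem_powersetCard.1 hb).2]
    simp [pow_succ]

/-- Under the substitution `T_j = T (1 - ρ_j)`, where `T = 1 + z T ^ (2 d + 1)`, the tree recurrence
for `T_j` is the main equation for `ρ_j`: the product `∏ (1 - ρ_{j + k})` is expanded over the
subsets of `{-d, …, d}`. -/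
theorem treeEquation_iff_mainEquation {A : Type*} [CommRing A] {d : ℕ} {z T : A} (hT : IsUnit T)
    (hz : T = 1 + z * T ^ (2 * d + 1)) (ρ : ℤ → A) (j : ℤ) :
    TreeEquation d z (fun i => T * (1 - ρ i)) j ↔ MainEquation d (z * T ^ (2 * d)) ρ j := by
  have hcard : #(Icc (-(d : ℤ)) d) = 2 * d + 1 := by simp; omega
  unfold TreeEquation MainEquation
  rw [prod_mul_distrib, prod_const, hcard, prod_one_sub_eq d fun k => ρ (j + k),
    ← hT.mul_right_inj (b := ρ j)]
  simp only
  constructor <;> intro h <;> linear_combination hz - h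

/-! ### Coefficients of the main equation -/

variable {F : Type*} [Field F] {d : ℕ}

theorem monom_add_left {X : Fin d → LaurentSeries F} (hX : ∀ l, X l ≠ 0) (j k : ℤ)
    (n : Fin d →₀ ℕ) : monom X (j + k) n = monom X j n * monom X k n := by
  simp only [monom, ← prod_mul_distrib]
  exact prod_congr rfl fun l _ => by rw [add_mul, zpow_add₀ (hX l)]

@[simp] theorem monom_zero_right (X : Fin d → LaurentSeries F) (j : ℤ) : monom X j 0 = 1 := by
  simp [monom]

theorem monom_add_right {X : Fin d → LaurentSeries F} (hX : ∀ l, X l ≠ 0) (j : ℤ)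
    (m n : Fin d →₀ ℕ) : monom X j (m + n) = monom X j m * monom X j n := by
  simp only [monom, ← prod_mul_distrib]
  exact prod_congr rfl fun l _ => by rw [← zpow_add₀ (hX l)]; simp [mul_add]

theorem monom_sum_right {X : Fin d → LaurentSeries F} (hX : ∀ l, X l ≠ 0) (j : ℤ)
    (b : Finset ℤ) (g : ℤ → Fin d →₀ ℕ) :
    monom X j (∑ k ∈ b, g k) = ∏ k ∈ b, monom X j (g k) := by
  classical
  induction b using Finset.induction_on with
  | empty => simp
  | insert k b hk ih => rw [sum_insert hk, prod_insert hk, monom_add_right hX, ih]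

theorem monom_eq_zpow {X : Fin d → LaurentSeries F} (j : ℤ) (n : Fin d →₀ ℕ) :
    monom X j n = monom X 1 n ^ j := by
  simp only [monom, ← prod_zpow]
  exact prod_congr rfl fun l _ => by rw [one_mul, ← zpow_mul, mul_comm]

theorem monom_ne_zero {X : Fin d → LaurentSeries F} (hX : ∀ l, X l ≠ 0) (j : ℤ)
    (n : Fin d →₀ ℕ) : monom X j n ≠ 0 :=
  prod_ne_zero_iff.2 fun l _ => zpow_ne_zero _ (hX l)

theorem monom_single (X : Fin d → LaurentSeries F) (j : ℤ) (l : Fin d) (k : ℕ) :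
    monom X j (Finsupp.single l k) = X l ^ (j * k) := by
  rw [monom, prod_eq_single l] <;> simp +contextual [eq_comm]

theorem coeff_rhoFormal (X : Fin d → LaurentSeries F) (α : (Fin d →₀ ℕ) → LaurentSeries F) (j : ℤ)
    (n : Fin d →₀ ℕ) : MvPowerSeries.coeff n (rhoFormal X α j) = α n * monom X j n := rfl

theorem coeff_prod_rhoFormal {X : Fin d → LaurentSeries F} (hX : ∀ l, X l ≠ 0)
    {α : (Fin d →₀ ℕ) → LaurentSeries F} (h0 : α 0 = 0) (j : ℤ) (b : Finset ℤ) (n : Fin d →₀ ℕ) :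
    MvPowerSeries.coeff n (∏ k ∈ b, rhoFormal X α (j + k)) = monom X j n *
      ∑ g ∈ (piAntidiag b n).filter (fun g => ∀ k ∈ b, g k ≠ 0),
          (∏ k ∈ b, α (g k)) * ∏ k ∈ b, monom X k (g k) := by
  classical
  rw [sum_filter_of_ne, MvPowerSeries.coeff_prod, mul_sum]
  · refine sum_bij' (fun g _ => ⇑g) (fun g hg => Finsupp.onFinset b g (mem_piAntidiag.1 hg).2)
      ?_ ?_ ?_ ?_ ?_
    · intro g hg
      rw [mem_finsuppAntidiag] at hg
      exact mem_piAntidiag.2 ⟨hg.1, fun i hi => hg.2 (Finsupp.mem_support_iff.2 hi)⟩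
    · intro g hg
      rw [mem_finsuppAntidiag]
      exact ⟨(mem_piAntidiag.1 hg).1, Finsupp.support_onFinset_subset⟩
    · intro g hg; ext; simp
    · intro g hg; ext; simp
    · intro g hg
      rw [mem_finsuppAntidiag] at hg
      rw [← hg.1, monom_sum_right hX, ← prod_mul_distrib, ← prod_mul_distrib]
      refine prod_congr rfl fun k _ => ?_
      rw [coeff_rhoFormal, monom_add_left hX]
      ring
  · intro g _ hne k hk hgk
    exact hne (by rw [prod_eq_zero hk (by rw [hgk, h0]), zero_mul])

/-- The coefficient of `w ^ n` in the formal main equation at `j` is, up to the factor `X ^ (j n)`,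
the recurrence at `n`; in particular it does not depend on `j`. -/
theorem coeff_mainEquation_iff_recurrence [NeZero d] {X : Fin d → LaurentSeries F}
    (hX : ∀ l, X l ≠ 0)
    {Z : LaurentSeries F} (hZ : Z = z F d * T F d ^ (2 * d)) (hZ0 : Z ≠ 0)
    {α : (Fin d →₀ ℕ) → LaurentSeries F} (h0 : α 0 = 0) (j : ℤ) (n : Fin d →₀ ℕ) :
    MvPowerSeries.coeff n (rhoFormal X α j) = MvPowerSeries.coeff n (MvPowerSeries.C Z *
      ∑ l ∈ Icc 1 (2 * d + 1), (-1) ^ (l - 1) *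
        ∑ b ∈ powersetCard l (Icc (-(d : ℤ)) d), ∏ k ∈ b, rhoFormal X α (j + k)) ↔
      Recurrence X α n := by
  set R : Finset ℤ → LaurentSeries F := fun b =>
    ∑ g ∈ (piAntidiag b n).filter (fun g => ∀ k ∈ b, g k ≠ 0),
          (∏ k ∈ b, α (g k)) * ∏ k ∈ b, monom X k (g k) with hR
  have hcoeff : ∀ l : ℕ, MvPowerSeries.coeff n ((-1) ^ (l - 1) *
      ∑ b ∈ powersetCard l (Icc (-(d : ℤ)) d), ∏ k ∈ b, rhoFormal X α (j + k)) =
      monom X j n * ((-1) ^ (l - 1) * ∑ b ∈ powersetCard l (Icc (-(d : ℤ)) d), R b) := by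
    intro l
    have : ((-1) ^ (l - 1) : MvPowerSeries (Fin d) (LaurentSeries F)) =
        MvPowerSeries.C ((-1) ^ (l - 1)) := by simp
    rw [this, MvPowerSeries.coeff_C_mul, map_sum, mul_left_comm, mul_sum (a := monom X j n)]
    simp only [coeff_prod_rhoFormal hX h0, hR]
  -- the singletons `b = {k}` only admit `g_k = n`; they make up the left-hand side of the
  -- recurrence
  have hone : ∑ b ∈ powersetCard 1 (Icc (-(d : ℤ)) d), R b =
      α n * ∑ k ∈ Icc (-(d : ℤ)) d, monom X k n := by
    rw [powersetCard_one, sum_map, mul_sum]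
    refine sum_congr rfl fun k _ => ?_
    rw [hR]
    simp only [Function.Embedding.coeFn_mk, sum_filter]
    rw [sum_eq_single (Pi.single k n)]
    · by_cases hn : n = 0 <;> simp [hn, h0]
    · intro g hg hne
      exfalso
      apply hne
      rw [mem_piAntidiag] at hg
      ext i : 1
      by_cases hi : i = k
      · subst hi; simpa using hg.1
      · rw [Pi.single_eq_of_ne hi]
        by_contra h
        exact hi (by simpa using hg.2 i h)
    · intro h
      exfalso
      apply h
      rw [mem_piAntidiag]
      refine ⟨by simp, fun i hi => ?_⟩
      by_contra hik
      exact hi (Pi.single_eq_of_ne (by simpa using hik) _)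
  have hsplit : Icc 1 (2 * d + 1) = insert 1 (Icc 2 (2 * d + 1)) := by ext; simp; omega
  have hneg : ∑ l ∈ Icc 2 (2 * d + 1), (-1) ^ (l - 1) *
      ∑ b ∈ powersetCard l (Icc (-(d : ℤ)) d), R b =
      -∑ l ∈ Icc 2 (2 * d + 1), (-1) ^ l * ∑ b ∈ powersetCard l (Icc (-(d : ℤ)) d), R b := by
    rw [← sum_neg_distrib]
    refine sum_congr rfl fun l hl => ?_
    obtain ⟨l, rfl⟩ : ∃ m, l = m + 1 := ⟨l - 1, by simp at hl; omega⟩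
    simp [pow_succ]
  rw [MvPowerSeries.coeff_C_mul, map_sum, sum_congr rfl fun l _ => hcoeff l, ← mul_sum, hsplit,
    sum_insert (by simp), hone, hneg, coeff_rhoFormal]
  have hm := monom_ne_zero hX j n
  unfold Recurrence
  rw [← hZ]
  change _ ↔ _ = ∑ l ∈ Icc 2 (2 * d + 1), (-1) ^ l *
    ∑ b ∈ powersetCard l (Icc (-(d : ℤ)) d), R b
  generalize ∑ l ∈ Icc 2 (2 * d + 1), (-1) ^ l *
    ∑ b ∈ powersetCard l (Icc (-(d : ℤ)) d), R b = S
  generalize ∑ k ∈ Icc (-(d : ℤ)) d, monom X k n = P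
  constructor
  · intro h
    have h' : α n = Z * (α n * P - S) := mul_right_cancel₀ hm (by
      rw [h]; simp; ring)
    field_simp
    linear_combination -h'
  · intro h
    rw [← h]
    simp
    field_simp
    ring

/-- The formal main equations hold for all `j` if and only if the recurrence holds at every
index. -/
theorem mainEquation_rhoFormal_iff [NeZero d] {X : Fin d → LaurentSeries F}
    (hX : ∀ l, X l ≠ 0) (hZ0 : z F d * T F d ^ (2 * d) ≠ 0)
    {α : (Fin d →₀ ℕ) → LaurentSeries F} (h0 : α 0 = 0) (j : ℤ) :
    MainEquation d (MvPowerSeries.C (z F d * T F d ^ (2 * d))) (rhoFormal X α) j ↔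
      ∀ n, Recurrence X α n := by
  unfold MainEquation
  rw [MvPowerSeries.ext_iff]
  exact forall_congr' fun n => coeff_mainEquation_iff_recurrence hX rfl hZ0 h0 j n

/-! ### Valuations -/

theorem sum_Icc_zpow {K : Type*} [Field K] {x : K} (hx : x ≠ 0) (d : ℕ) :
    ∑ l ∈ Icc (-(d : ℤ)) d, x ^ l = (x ^ d)⁻¹ * ∑ i ∈ range (2 * d + 1), x ^ i := by
  rw [mul_sum]
  symm
  refine sum_bij' (fun i _ => (i : ℤ) - d) (fun l _ => (l + d).toNat) ?_ ?_ ?_ ?_ ?_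
  · intro i hi; simp at hi ⊢; omega
  · intro l hl; simp at hl ⊢; omega
  · intro i hi; simp
  · intro l hl; simp at hl ⊢; omega
  · intro i hi
    rw [zpow_sub₀ hx, zpow_natCast, zpow_natCast, div_eq_inv_mul]

theorem valuation_geom_sum {x : LaurentSeries F} (hx : Valued.v x < 1) (m : ℕ) :
    Valued.v (∑ i ∈ range (m + 1), x ^ i) = 1 := by
  rw [sum_range_succ', pow_zero, add_comm]
  refine Valuation.map_one_add_of_lt _ (Valuation.map_sum_lt _ one_ne_zero fun i _ => ?_)
  rw [map_pow]
  exact pow_lt_one₀ zero_le hx (by simp)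

theorem valuation_sum_Icc_zpow {x : LaurentSeries F} (hx0 : x ≠ 0) (hx : Valued.v x < 1) (d : ℕ) :
    Valued.v (∑ l ∈ Icc (-(d : ℤ)) d, x ^ l) = (Valued.v x ^ d)⁻¹ := by
  rw [sum_Icc_zpow hx0, map_mul, valuation_geom_sum hx, map_inv₀, map_pow, mul_one]

theorem valuation_z (F : Type*) [Field F] (d : ℕ) :
    Valued.v (z F d) = WithZero.exp (-(d : ℤ)) :=
  LaurentSeries.valuation_single_zpow F d

theorem z_eq_pow (F : Type*) [Field F] (d : ℕ) :
    z F d = (HahnSeries.single (1 : ℤ) (1 : F) : LaurentSeries F) ^ d := by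
  rw [z, HahnSeries.single_pow]; simp

theorem z_ne_zero (F : Type*) [Field F] (d : ℕ) : z F d ≠ 0 :=
  HahnSeries.single_ne_zero one_ne_zero

theorem T_eq (F : Type*) [Field F] (d : ℕ) [NeZero d] :
    T F d = 1 + z F d * T F d ^ (2 * d + 1) := by
  conv_lhs => rw [T, MaryTree.series_eq]
  simp only [T, map_add, map_mul, map_pow, map_one, PowerSeries.expand_X, z_eq_pow,
    HahnSeries.ofPowerSeries_X]

theorem exp_neg_natCast_lt_one [NeZero d] : WithZero.exp (-(d : ℤ)) < 1 := by
  have := NeZero.pos d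
  rw [← WithZero.exp_zero, WithZero.exp_lt_exp]
  omega

theorem valuation_T (F : Type*) [Field F] (d : ℕ) [NeZero d] : Valued.v (T F d) = 1 := by
  have h1 : Valued.v (T F d) ≤ 1 := (LaurentSeries.val_le_one_iff_eq_coe F _).2 ⟨_, rfl⟩
  rw [T_eq]
  refine Valuation.map_one_add_of_lt _ ?_
  rw [map_mul, map_pow, valuation_z]
  exact mul_lt_one_of_lt_of_le exp_neg_natCast_lt_one (pow_le_one₀ zero_le h1)

theorem T_ne_zero (F : Type*) [Field F] (d : ℕ) [NeZero d] : T F d ≠ 0 := by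
  intro h
  simpa [h] using valuation_T F d

theorem valuation_z_mul_T_pow (F : Type*) [Field F] (d : ℕ) [NeZero d] :
    Valued.v (z F d * T F d ^ (2 * d)) = WithZero.exp (-(d : ℤ)) := by
  rw [map_mul, map_pow, valuation_T, valuation_z, one_pow, mul_one]

theorem z_mul_T_pow_ne_zero (F : Type*) [Field F] (d : ℕ) [NeZero d] :
    z F d * T F d ^ (2 * d) ≠ 0 :=
  mul_ne_zero (z_ne_zero F d) (pow_ne_zero _ (T_ne_zero F d))

theorem ne_zero_of_mem_smallRoots [NeZero d] {x : LaurentSeries F} (hx : x ∈ smallRoots F d) :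
    x ≠ 0 := by
  rintro rfl
  have h : ∑ l ∈ Icc (-(d : ℤ)) d, (0 : LaurentSeries F) ^ l = 1 := by
    rw [sum_eq_single 0] <;> simp +contextual [zero_zpow]
  have h1 := hx.1
  rw [h, mul_one] at h1
  have h2 := valuation_z_mul_T_pow F d
  rw [← h1, map_one] at h2
  exact exp_neg_natCast_lt_one.ne' h2

/-- Comparing orders in `x ^ d = z T ^ (2 d) (1 + x + ⋯ + x ^ (2 d))` shows that a small root has
order exactly one. -/
theorem valuation_of_mem_smallRoots [NeZero d] {x : LaurentSeries F} (hx : x ∈ smallRoots F d) :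
    Valued.v x = WithZero.exp (-1 : ℤ) := by
  have h0 := ne_zero_of_mem_smallRoots hx
  have hv : Valued.v x ≠ 0 := (Valuation.ne_zero_iff _).2 h0
  have h1 := congrArg Valued.v hx.1
  rw [map_one, map_mul, valuation_z_mul_T_pow, valuation_sum_Icc_zpow h0 hx.2] at h1
  have h2 : Valued.v x ^ d = WithZero.exp (-1 : ℤ) ^ d := by
    rw [← WithZero.exp_nsmul]
    rw [eq_mul_inv_iff_mul_eq₀ (pow_ne_zero _ hv), one_mul] at h1
    rw [h1]
    simp
  exact (pow_left_inj₀ zero_le zero_le (NeZero.ne d)).1 h2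

/-! ### The small roots -/

/-- With `u = t / x` in place of `x`, the characteristic equation becomes
`u ^ (2 d) + t u ^ (2 d - 1) + ⋯ + t ^ (2 d) = u ^ d / W`, which is monic in `u` and, unlike the
original one, has simple nonzero roots modulo `t`. -/
theorem charEq_iff {K : Type*} [Field K] {x u t W : K} (hx : x ≠ 0) (hu : u ≠ 0) (hW : W ≠ 0)
    (hxu : x * u = t) (d : ℕ) :
    1 = t ^ d * W * ∑ l ∈ Icc (-(d : ℤ)) d, x ^ l ↔
      u ^ (2 * d) + (∑ i ∈ range (2 * d), t ^ (i + 1) * u ^ (2 * d - 1 - i) - W⁻¹ * u ^ d) = 0 := by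
  have h : u ^ (2 * d) * ∑ i ∈ range (2 * d + 1), x ^ i =
      u ^ (2 * d) + ∑ i ∈ range (2 * d), t ^ (i + 1) * u ^ (2 * d - 1 - i) := by
    rw [sum_range_succ', pow_zero, mul_add, mul_one, add_comm, mul_sum]
    congr 1
    refine sum_congr rfl fun i hi => ?_
    rw [← hxu, mul_pow, mul_assoc, ← pow_add, mul_comm]
    congr 2
    have := mem_range.1 hi
    omega
  rw [← add_sub_assoc, ← h, sum_Icc_zpow hx, ← hxu, mul_pow]
  generalize ∑ i ∈ range (2 * d + 1), x ^ i = G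
  have hud : u ^ (2 * d) = u ^ d * u ^ d := by ring
  rw [hud]
  have hud0 := pow_ne_zero d hu
  have hxd0 := pow_ne_zero d hx
  have e : u ^ d * u ^ d * G - W⁻¹ * u ^ d = u ^ d * W⁻¹ * (u ^ d * W * G - 1) := by
    field_simp
  have e' : x ^ d * u ^ d * W * ((x ^ d)⁻¹ * G) = u ^ d * W * G := by field_simp
  rw [e, e', mul_eq_zero, sub_eq_zero, eq_comm]
  simp [hud0, hW]

/-- The monic polynomial satisfied by `u = t / x` for a solution `x` of the characteristic equation;
`V` stands for `T ^ (-2 d)`. -/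
def reversedCharPoly (d : ℕ) (V : PowerSeries F) : Polynomial (PowerSeries F) :=
  Polynomial.X ^ (2 * d) +
    (∑ i ∈ range (2 * d), Polynomial.C (PowerSeries.X ^ (i + 1)) * Polynomial.X ^ (2 * d - 1 - i) -
      Polynomial.C V * Polynomial.X ^ d)

theorem reversedCharPoly_monic [NeZero d] (V : PowerSeries F) : (reversedCharPoly d V).Monic := by
  have hd := NeZero.pos d
  refine Polynomial.monic_X_pow_add (lt_of_le_of_lt (Polynomial.degree_sub_le _ _)
    (max_lt ?_ ?_))
  · refine (Polynomial.degree_sum_le _ _).trans_lt ((Finset.sup_lt_iff (WithBot.bot_lt_coe _)).2 ?_)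
    intro i hi
    refine (Polynomial.degree_C_mul_X_pow_le _ _).trans_lt ?_
    exact_mod_cast (by omega : 2 * d - 1 - i < 2 * d)
  · refine (Polynomial.degree_C_mul_X_pow_le _ _).trans_lt ?_
    exact_mod_cast (by omega : d < 2 * d)

theorem map_reversedCharPoly {V : PowerSeries F} (hV : PowerSeries.constantCoeff V = 1) :
    (reversedCharPoly d V).map (PowerSeries.constantCoeff (R := F)) =
      Polynomial.X ^ (2 * d) - Polynomial.X ^ d := by
  simp [reversedCharPoly, Polynomial.map_sum, hV, sub_eq_add_neg]

theorem eval_derivative_X_pow_sub_X_pow {c : F} (hc : c ^ d = 1) :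
    c * (Polynomial.derivative (Polynomial.X ^ (2 * d) - Polynomial.X ^ d : Polynomial F)).eval c =
      d := by
  rcases d with _ | d
  · simp
  · have h2 : c ^ (2 * (d + 1)) = 1 := by rw [mul_comm, pow_mul, hc, one_pow]
    have h3 : c * c ^ (2 * (d + 1) - 1) = 1 := by
      rw [← pow_succ', ← h2]; congr 1
    have h4 : c * c ^ d = 1 := by rw [← pow_succ', hc]
    simp only [Polynomial.derivative_sub, Polynomial.derivative_X_pow, Polynomial.eval_sub,
      Polynomial.eval_mul, Polynomial.eval_C, Polynomial.eval_pow, Polynomial.eval_X,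
      Nat.add_sub_cancel]
    push_cast
    linear_combination (2 * (d + 1) : F) * h3 - (d + 1 : F) * h4

/-- Hensel's lemma for power series over a field: a simple root of the reduction of a monic
polynomial lifts uniquely. -/
theorem existsUnique_root_of_constantCoeff {f : Polynomial (PowerSeries F)} (hf : f.Monic) {c : F}
    (h0 : (f.map (PowerSeries.constantCoeff (R := F))).eval c = 0)
    (h1 : (f.map (PowerSeries.constantCoeff (R := F))).derivative.eval c ≠ 0) :
    ∃! u : PowerSeries F, f.eval u = 0 ∧ PowerSeries.constantCoeff u = c := by
  have key : ∀ u : PowerSeries F, PowerSeries.constantCoeff u = c →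
      PowerSeries.constantCoeff (f.eval u) = 0 ∧
        PowerSeries.constantCoeff (f.derivative.eval u) ≠ 0 := by
    intro u hu
    rw [← Polynomial.eval_map_apply, ← Polynomial.eval_map_apply, ← Polynomial.derivative_map, hu]
    exact ⟨h0, h1⟩
  obtain ⟨k0, k1⟩ := key (PowerSeries.C c) (by simp)
  obtain ⟨u, hu, huc⟩ := HenselianRing.is_henselian
    (I := Ideal.span {(PowerSeries.X : PowerSeries F)}) f hf (PowerSeries.C c)
    (by rw [Ideal.mem_span_singleton, PowerSeries.X_dvd_iff]; exact k0)
    (IsUnit.map _ (PowerSeries.isUnit_iff_constantCoeff.2 k1.isUnit))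
  rw [Ideal.mem_span_singleton, PowerSeries.X_dvd_iff, map_sub, PowerSeries.constantCoeff_C,
    sub_eq_zero] at huc
  refine ⟨u, ⟨hu, huc⟩, ?_⟩
  rintro u' ⟨hu', huc'⟩
  -- expand `f` at `u`: in `0 = f (u + h) = (f' u + k h) h` the first factor is a unit
  obtain ⟨k, hk⟩ := Polynomial.binomExpansion f u (u' - u)
  rw [add_sub_cancel, hu', hu.eq_zero, zero_add] at hk
  have hk' : (f.derivative.eval u + k * (u' - u)) * (u' - u) = 0 := by
    rw [hk]; ring
  rcases mul_eq_zero.1 hk' with h | h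
  · exfalso
    have := congrArg (PowerSeries.constantCoeff (R := F)) h
    simp only [map_add, map_mul, map_sub, huc, huc', sub_self, mul_zero, add_zero, map_zero] at this
    exact (key u huc).2 this
  · exact sub_eq_zero.1 h

/-- The small roots correspond to the roots of the reversed polynomial that are units. -/
theorem mem_smallRoots_iff [NeZero d] {V : PowerSeries F}
    (hV : HahnSeries.ofPowerSeries ℤ F V = (T F d ^ (2 * d))⁻¹) (x : LaurentSeries F) :
    x ∈ smallRoots F d ↔ ∃ u : PowerSeries F, ((reversedCharPoly d V).eval u = 0 ∧
      PowerSeries.constantCoeff u ≠ 0) ∧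
        x * HahnSeries.ofPowerSeries ℤ F u = HahnSeries.single (1 : ℤ) (1 : F) := by
  have ht : Valued.v (HahnSeries.single (1 : ℤ) (1 : F)) = WithZero.exp (-1 : ℤ) :=
    LaurentSeries.valuation_single_zpow F 1
  have ht0 : (HahnSeries.single (1 : ℤ) (1 : F)) ≠ 0 := HahnSeries.single_ne_zero one_ne_zero
  have hW : T F d ^ (2 * d) ≠ 0 := pow_ne_zero _ (T_ne_zero F d)
  have heval : ∀ u : PowerSeries F, (reversedCharPoly d V).eval u = 0 ↔
      HahnSeries.ofPowerSeries ℤ F u ^ (2 * d) +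
        (∑ i ∈ range (2 * d), (HahnSeries.single (1 : ℤ) (1 : F)) ^ (i + 1) *
          HahnSeries.ofPowerSeries ℤ F u ^ (2 * d - 1 - i) -
          (T F d ^ (2 * d))⁻¹ * HahnSeries.ofPowerSeries ℤ F u ^ d) = 0 := by
    intro u
    rw [← (map_eq_zero_iff (HahnSeries.ofPowerSeries ℤ F) HahnSeries.ofPowerSeries_injective)]
    simp only [reversedCharPoly, Polynomial.eval_add, Polynomial.eval_sub, Polynomial.eval_mul,
      Polynomial.eval_pow, Polynomial.eval_X, Polynomial.eval_C, Polynomial.eval_finsetSum,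
      map_add, map_sub, map_mul, map_pow, map_sum, hV, HahnSeries.ofPowerSeries_X]
  constructor
  · intro hx
    have hx0 := ne_zero_of_mem_smallRoots hx
    have hvx := valuation_of_mem_smallRoots hx
    have hvu : Valued.v (HahnSeries.single (1 : ℤ) (1 : F) / x) = 1 := by
      rw [map_div₀, ht, hvx, div_self (by simp)]
    obtain ⟨u, hu⟩ := (LaurentSeries.val_le_one_iff_eq_coe F _).1 hvu.le
    have hxu : x * HahnSeries.ofPowerSeries ℤ F u = HahnSeries.single (1 : ℤ) (1 : F) := by
      rw [hu, mul_div_cancel₀ _ hx0]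
    have hu0 : HahnSeries.ofPowerSeries ℤ F u ≠ 0 := by rw [hu]; exact div_ne_zero ht0 hx0
    refine ⟨u, ⟨?_, ?_⟩, hxu⟩
    · rw [heval, ← charEq_iff hx0 hu0 hW hxu, ← z_eq_pow]
      exact hx.1
    · intro h
      have := (LaurentSeries.intValuation_le_iff_coeff_lt_eq_zero F (d := 1) u).2 (by
        intro n hn
        obtain rfl : n = 0 := by omega
        simpa using h)
      rw [hu, hvu, ← WithZero.exp_zero, WithZero.exp_le_exp] at this
      norm_num at this
  · rintro ⟨u, ⟨hu, huc⟩, hxu⟩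
    have hx0 : x ≠ 0 := by rintro rfl; exact ht0 (by rw [← hxu, zero_mul])
    have hu0 : HahnSeries.ofPowerSeries ℤ F u ≠ 0 := by
      intro h; exact ht0 (by rw [← hxu, h, mul_zero])
    have hvu : Valued.v (HahnSeries.ofPowerSeries ℤ F u) = 1 := by
      have h1 := (LaurentSeries.val_le_one_iff_eq_coe F _).2 ⟨u, rfl⟩
      have h2 := (LaurentSeries.val_le_one_iff_eq_coe F _).2 ⟨u⁻¹, rfl⟩
      have h3 := congrArg (fun y => Valued.v (HahnSeries.ofPowerSeries ℤ F y))
        (PowerSeries.mul_inv_cancel u huc)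
      simp only [map_mul, map_one] at h3
      refine le_antisymm h1 ?_
      rw [← h3]
      exact mul_le_of_le_one_right' h2
    have hvx : Valued.v x = WithZero.exp (-1 : ℤ) := by
      rw [← ht, ← hxu, map_mul, hvu, mul_one]
    refine ⟨?_, ?_⟩
    · rw [z_eq_pow, charEq_iff hx0 hu0 hW hxu, ← heval]
      exact hu
    · rw [hvx, ← WithZero.exp_zero, WithZero.exp_lt_exp]
      norm_num

/-- The small roots `x` correspond to the `d`-th roots of unity in `F`, which are the leading
coefficients of the series `t / x`. -/
theorem ncard_smallRoots [Algebra ℂ F] [NeZero d] : (smallRoots F d).ncard = d := by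
  classical
  have : CharZero F := charZero_of_injective_algebraMap (algebraMap ℂ F).injective
  let U : PowerSeries F := PowerSeries.expand d (NeZero.ne d) (MaryTree.series F (2 * d + 1))
  have hU : PowerSeries.constantCoeff U = 1 := by
    simp [U, MaryTree.series, MaryTree.count_zero]
  let V := (U ^ (2 * d))⁻¹
  have hU' : PowerSeries.constantCoeff (U ^ (2 * d)) ≠ 0 := by simp [hU]
  have hVc : PowerSeries.constantCoeff V = 1 := by simp [V, hU]
  have hV : HahnSeries.ofPowerSeries ℤ F V = (T F d ^ (2 * d))⁻¹ := by
    refine eq_inv_of_mul_eq_one_left ?_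
    rw [T, ← map_pow, ← map_mul, PowerSeries.inv_mul_cancel _ hU', map_one]
  have ht0 : (HahnSeries.single (1 : ℤ) (1 : F)) ≠ 0 := HahnSeries.single_ne_zero one_ne_zero
  set P : Set (PowerSeries F) := {u | (reversedCharPoly d V).eval u = 0 ∧
      PowerSeries.constantCoeff u ≠ 0} with hP
  have hne : ∀ u ∈ P, HahnSeries.ofPowerSeries ℤ F u ≠ 0 := by
    intro u hu h
    rw [map_eq_zero_iff _ HahnSeries.ofPowerSeries_injective] at h
    exact hu.2 (by rw [h, map_zero])
  have h1 : Set.BijOn (fun u => HahnSeries.single (1 : ℤ) (1 : F) / HahnSeries.ofPowerSeries ℤ F u)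
      P (smallRoots F d) := by
    refine ⟨fun u hu => ?_, fun u hu u' hu' h => ?_, fun x hx => ?_⟩
    · exact (mem_smallRoots_iff hV _).2 ⟨u, hu, div_mul_cancel₀ _ (hne u hu)⟩
    · have h' := h
      simp only [div_eq_mul_inv] at h'
      exact HahnSeries.ofPowerSeries_injective (inv_injective (mul_left_cancel₀ ht0 h'))
    · obtain ⟨u, hu, hxu⟩ := (mem_smallRoots_iff hV x).1 hx
      exact ⟨u, hu, by simp only [← hxu]; rw [mul_div_cancel_right₀ _ (hne u hu)]⟩
  have hlift : ∀ c : F, c ^ d = 1 → ∃! u : PowerSeries F, (reversedCharPoly d V).eval u = 0 ∧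
      PowerSeries.constantCoeff u = c := by
    intro c hc
    refine existsUnique_root_of_constantCoeff (reversedCharPoly_monic V) ?_ ?_
    · rw [map_reversedCharPoly hVc]
      simp [mul_comm 2 d, pow_mul, hc]
    · rw [map_reversedCharPoly hVc]
      intro h
      have := eval_derivative_X_pow_sub_X_pow hc
      rw [h, mul_zero] at this
      exact NeZero.ne d (by exact_mod_cast this.symm)
  have hroot : ∀ u ∈ P, PowerSeries.constantCoeff u ^ d = 1 := by
    rintro u ⟨hu, huc⟩
    have := Polynomial.eval_map_apply (p := reversedCharPoly d V)
      (PowerSeries.constantCoeff (R := F)) u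
    rw [hu, map_zero, map_reversedCharPoly hVc] at this
    simp only [Polynomial.eval_sub, Polynomial.eval_pow, Polynomial.eval_X] at this
    refine mul_left_cancel₀ (pow_ne_zero d huc) ?_
    linear_combination this
  have h2 : Set.BijOn (PowerSeries.constantCoeff (R := F)) P
      (Polynomial.nthRootsFinset d (1 : F) : Finset F) := by
    refine ⟨fun u hu => ?_, fun u hu u' hu' h => ?_, fun c hc => ?_⟩
    · rw [mem_coe, Polynomial.mem_nthRootsFinset (NeZero.pos d)]
      exact hroot u hu
    · exact (hlift _ (hroot u hu)).unique ⟨hu.1, rfl⟩ ⟨hu'.1, h.symm⟩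
    · rw [mem_coe, Polynomial.mem_nthRootsFinset (NeZero.pos d)] at hc
      obtain ⟨u, ⟨hu, huc⟩, -⟩ := hlift c hc
      refine ⟨u, ⟨hu, ?_⟩, huc⟩
      rintro h
      rw [← huc, h, zero_pow (NeZero.ne d)] at hc
      exact zero_ne_one hc
  have hprim := (Complex.isPrimitiveRoot_exp d (NeZero.ne d)).map_of_injective
    (algebraMap ℂ F).injective
  rw [← h1.ncard_eq, h2.ncard_eq, Set.ncard_coe_finset, hprim.card_nthRootsFinset]

/-! ### The solution on a coordinate axis -/

section Axis

variable {K : Type*} [Field K]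

open Classical in
/-- The geometric series `∑_k c ^ k w_l ^ k` in the variable `w_l`. -/
def axisGeom {σ : Type*} (l : σ) (c : K) : MvPowerSeries σ K :=
  fun n => if n = Finsupp.single l (n l) then c ^ n l else 0

theorem coeff_axisGeom_single {σ : Type*} (l : σ) (c : K) (k : ℕ) :
    MvPowerSeries.coeff (Finsupp.single l k) (axisGeom l c) = c ^ k := by
  change axisGeom l c (Finsupp.single l k) = _
  simp [axisGeom]

theorem coeff_axisGeom_of_ne {σ : Type*} (l : σ) (c : K) {n : σ →₀ ℕ}
    (hn : ∀ k, n ≠ Finsupp.single l k) : MvPowerSeries.coeff n (axisGeom l c) = 0 :=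
  if_neg (hn _)

theorem one_sub_mul_axisGeom {σ : Type*} (l : σ) (c : K) :
    (1 - MvPowerSeries.C c * MvPowerSeries.X l) * axisGeom l c = 1 := by
  classical
  ext n
  have hX : MvPowerSeries.C c * MvPowerSeries.X l =
      MvPowerSeries.monomial (Finsupp.single l 1) c := by
    rw [MvPowerSeries.X, ← MvPowerSeries.monomial_zero_eq_C_apply,
      MvPowerSeries.monomial_mul_monomial, zero_add, mul_one]
  rw [sub_mul, one_mul, hX, map_sub, MvPowerSeries.coeff_monomial_mul, MvPowerSeries.coeff_one]
  by_cases hn : ∃ k, n = Finsupp.single l k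
  · obtain ⟨k, rfl⟩ := hn
    rcases k with _ | k
    · rw [coeff_axisGeom_single]
      simp
    · rw [← Finsupp.single_tsub, coeff_axisGeom_single, coeff_axisGeom_single]
      simp [pow_succ']
  · push Not at hn
    have h0 : n ≠ 0 := by simpa using hn 0
    rw [coeff_axisGeom_of_ne l c hn, if_neg h0]
    split_ifs with h
    · rw [coeff_axisGeom_of_ne l c, mul_zero, sub_zero]
      intro k hk
      apply hn (k + 1)
      rw [← tsub_add_cancel_of_le h, hk, ← Finsupp.single_add]
    · simp

/-- With `g = 1 / f`, the product of the quotients `f_i / f_{i+1}` telescopes. -/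
theorem prod_telescope {A : Type*} [CommRing A] {f g : ℤ → A} (hfg : ∀ i, f i * g i = 1) (s : ℤ)
    (m : ℕ) : ∏ i ∈ range m, f (s + i) * g (s + i + 1) = f s * g (s + m) := by
  induction m with
  | zero => simp [hfg]
  | succ m ih =>
    rw [prod_range_succ, ih]
    push_cast
    rw [← add_assoc]
    linear_combination f s * g (s + m + 1) * hfg (s + m)

theorem prod_Icc_eq_prod_range {A : Type*} [CommMonoid A] (f : ℤ → A) (d : ℕ) :
    ∏ k ∈ Icc (-(d : ℤ)) d, f k = ∏ i ∈ range (2 * d + 1), f (i - d) := by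
  symm
  refine prod_bij' (fun i _ => (i : ℤ) - d) (fun l _ => (l + d).toNat) ?_ ?_ ?_ ?_ ?_
  · intro i hi; simp at hi ⊢; omega
  · intro l hl; simp at hl ⊢; omega
  · intro i hi; simp
  · intro l hl; simp at hl ⊢; omega
  · intro i hi; rfl

theorem prod_Icc_telescope {A : Type*} [CommRing A] {f g : ℤ → A} (hfg : ∀ i, f i * g i = 1) (d : ℕ)
    (j : ℤ) : ∏ k ∈ Icc (-(d : ℤ)) d,
      (f (j + k - 1) * g (j + k)) * (f (j + k + d + 1) * g (j + k + d)) =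
      (f (j - d - 1) * g (j + d)) * (f (j + 2 * d + 1) * g j) := by
  have hgf : ∀ i, g i * f i = 1 := fun i => by rw [mul_comm, hfg]
  have h1 := prod_telescope hfg (j - d - 1) (2 * d + 1)
  have h2 := prod_telescope hgf j (2 * d + 1)
  rw [show j - d - 1 + ((2 * d + 1 : ℕ) : ℤ) = j + d by push_cast; ring] at h1
  rw [show j + ((2 * d + 1 : ℕ) : ℤ) = j + 2 * d + 1 by push_cast; ring] at h2
  rw [prod_Icc_eq_prod_range, prod_mul_distrib, mul_comm (f (j + 2 * d + 1)), ← h1, ← h2]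
  congr 1
  · refine prod_congr rfl fun i _ => ?_
    rw [show j + ((i : ℤ) - d) - 1 = j - d - 1 + i by ring,
      show j + ((i : ℤ) - d) = j - d - 1 + i + 1 by ring]
  · refine prod_congr rfl fun i _ => ?_
    rw [show j + ((i : ℤ) - d) + d = j + i by ring, mul_comm]

/-- Up to sign, the coefficient of `u` in
`T f_{j-1} f_{j+d+1} = f_j f_{j+d} + z T ^ (2 d + 1) f_{j-d-1} f_{j+2d+1}`, where
`f_i = 1 - u x ^ i` and `q` stands for `z T ^ (2 d)`: here the characteristic equation for `x` is
used. -/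
theorem linear_coeff_identity {x T q : K} (hx : x ≠ 0) (hT : T = 1 + q * T)
    (hq : 1 = q * ∑ l ∈ Icc (-(d : ℤ)) d, x ^ l) (j : ℤ) :
    T * (x ^ (j - 1) + x ^ (j + d + 1)) =
      x ^ j + x ^ (j + d) + q * T * (x ^ (j - d - 1) + x ^ (j + 2 * d + 1)) := by
  have hgeom : x ^ d * (1 - x) = q * (1 - x * (x ^ d) ^ 2) := by
    rw [sum_Icc_zpow hx] at hq
    have h := geom_sum_mul_neg x (2 * d + 1)
    have hp : x ^ (2 * d + 1) = x * (x ^ d) ^ 2 := by ring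
    rw [← hp, ← h]
    have hxd := pow_ne_zero d hx
    field_simp at hq
    linear_combination (1 - x) * hq
  have e : ∀ m : ℤ, x ^ (j + m) = x ^ j * x ^ m := fun m => zpow_add₀ hx _ _
  have h1 : x ^ (j - 1) = x ^ j * x⁻¹ := by rw [sub_eq_add_neg, e]; simp
  have h2 : x ^ (j + d + 1) = x ^ j * (x ^ d * x) := by rw [add_assoc, e, zpow_add_one₀ hx]; simp
  have h3 : x ^ (j + d) = x ^ j * x ^ d := by rw [e]; simp
  have h4 : x ^ (j - d - 1) = x ^ j * ((x ^ d)⁻¹ * x⁻¹) := by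
    rw [sub_sub, sub_eq_add_neg, e, zpow_neg, zpow_add_one₀ hx, mul_inv]; simp
  have h5 : x ^ (j + 2 * d + 1) = x ^ j * ((x ^ d) ^ 2 * x) := by
    rw [add_assoc, e, zpow_add_one₀ hx, mul_comm 2, zpow_mul]; simp
  rw [h1, h2, h3, h4, h5]
  have hxd := pow_ne_zero d hx
  generalize x ^ d = y at *
  generalize x ^ j = w at *
  field_simp
  linear_combination (w * (x * y - 1) * (1 - x * y ^ 2) + w * (1 + x ^ 2 * y ^ 3)) * hT +
    w * (1 - x * y) * T * hgeom

end Axis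

/-- The explicit coefficient `α_{k e}` on a coordinate axis with small root `x` and initial
value `a`. -/
def axisCoeff (d : ℕ) (x a : LaurentSeries F) (k : ℕ) : LaurentSeries F :=
  (a ^ k * x ^ (k - 1) * (1 - x ^ (k * d))) /
    ((1 - x ^ d) * (1 - x) ^ (k - 1) * (1 - x ^ (d + 1)) ^ (k - 1))

theorem axisCoeff_zero (x a : LaurentSeries F) : axisCoeff d x a 0 = 0 := by
  simp [axisCoeff]

theorem valuation_one_sub_pow {x : LaurentSeries F} (hx : Valued.v x < 1) {m : ℕ} (hm : m ≠ 0) :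
    Valued.v (1 - x ^ m) = 1 := by
  refine Valuation.map_one_sub_of_lt _ ?_
  rw [map_pow]
  exact pow_lt_one₀ zero_le hx hm

theorem one_sub_pow_ne_zero {x : LaurentSeries F} (hx : Valued.v x < 1) {m : ℕ} (hm : m ≠ 0) :
    1 - x ^ m ≠ 0 := by
  intro h
  simpa [h] using valuation_one_sub_pow hx hm

theorem axisCoeff_one [NeZero d] {x : LaurentSeries F} (hx : Valued.v x < 1)
    (a : LaurentSeries F) : axisCoeff d x a 1 = a := by
  have := one_sub_pow_ne_zero hx (NeZero.ne d)
  simp [axisCoeff, this]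

/-- The axis coefficient is a difference of two geometric sequences, valid for `k = 0` too. -/
theorem axisCoeff_eq [NeZero d] {x : LaurentSeries F} (hx0 : x ≠ 0) (hx : Valued.v x < 1)
    (a : LaurentSeries F) (k : ℕ) :
    axisCoeff d x a k = (1 - x) * (1 - x ^ (d + 1)) / x / (1 - x ^ d) *
      ((a * x / ((1 - x) * (1 - x ^ (d + 1)))) ^ k -
        (a * x / ((1 - x) * (1 - x ^ (d + 1))) * x ^ d) ^ k) := by
  rcases k with _ | k
  · simp [axisCoeff]
  · have h1 := one_sub_pow_ne_zero hx (NeZero.ne d)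
    have h2 : 1 - x ≠ 0 := by simpa using one_sub_pow_ne_zero hx one_ne_zero
    have h3 := one_sub_pow_ne_zero hx (Nat.succ_ne_zero d)
    rw [Nat.succ_eq_add_one] at h3
    have h4 : x ^ ((k + 1) * d) = (x ^ d) ^ (k + 1) := by rw [← pow_mul, mul_comm]
    simp only [axisCoeff, Nat.add_sub_cancel, h4]
    generalize x ^ d = y at *
    generalize 1 - x ^ (d + 1) = v at *
    generalize 1 - x = w at *
    rw [mul_pow _ y, div_pow]
    field_simp
    ring

/-- The family that is explicit on the `l`-th coordinate axis and vanishes outside it. -/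
def axisFamily (X a : Fin d → LaurentSeries F) (l : Fin d) (n : Fin d →₀ ℕ) : LaurentSeries F :=
  if n = Finsupp.single l (n l) then axisCoeff d (X l) (a l) (n l) else 0

theorem axisFamily_single (X a : Fin d → LaurentSeries F) (l : Fin d) (k : ℕ) :
    axisFamily X a l (Finsupp.single l k) = axisCoeff d (X l) (a l) k := by
  simp [axisFamily]

theorem rhoFormal_axisFamily [NeZero d] {X : Fin d → LaurentSeries F}
    (hX : ∀ l, X l ∈ smallRoots F d) (a : Fin d → LaurentSeries F) (l : Fin d)
    {B c : LaurentSeries F}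
    (hB : B = (1 - X l) * (1 - X l ^ (d + 1)) / X l)
    (hc : c = a l * X l / ((1 - X l) * (1 - X l ^ (d + 1)))) (j : ℤ) :
    rhoFormal X (axisFamily X a l) j = MvPowerSeries.C (B / (1 - X l ^ d)) *
      (axisGeom l (c * X l ^ j) - axisGeom l (c * X l ^ (j + d))) := by
  have hx0 := ne_zero_of_mem_smallRoots (hX l)
  ext n
  rw [coeff_rhoFormal, MvPowerSeries.coeff_C_mul, map_sub]
  by_cases hn : ∃ k, n = Finsupp.single l k
  · obtain ⟨k, rfl⟩ := hn
    rw [axisFamily_single, coeff_axisGeom_single, coeff_axisGeom_single, monom_single,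
      axisCoeff_eq hx0 (hX l).2, ← hB, ← hc, zpow_add₀ hx0, zpow_natCast, zpow_mul, zpow_natCast]
    ring_nf
  · push Not at hn
    rw [coeff_axisGeom_of_ne l _ hn, coeff_axisGeom_of_ne l _ hn, axisFamily, if_neg (hn _)]
    simp

/-- On a coordinate axis the family sums to the closed form
`T_j = T f_{j-1} f_{j+d+1} / (f_j f_{j+d})` with `f_i = 1 - c x ^ i w`. The product of the `T_{j+l}`
telescopes, and the tree equation reduces to a quadratic identity in `w`. -/
theorem treeEquation_axisFamily [NeZero d] {X : Fin d → LaurentSeries F}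
    (hX : ∀ l, X l ∈ smallRoots F d) (a : Fin d → LaurentSeries F) (l : Fin d) (j : ℤ) :
    TreeEquation d (MvPowerSeries.C (z F d))
      (fun i => MvPowerSeries.C (T F d) * (1 - rhoFormal X (axisFamily X a l) i)) j := by
  have hx0 := ne_zero_of_mem_smallRoots (hX l)
  have hx := (hX l).2
  have h1 := one_sub_pow_ne_zero hx (NeZero.ne d)
  have h2 : 1 - X l ≠ 0 := by simpa using one_sub_pow_ne_zero hx one_ne_zero
  have h3 : 1 - X l ^ (d + 1) ≠ 0 := one_sub_pow_ne_zero hx (Nat.succ_ne_zero d)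
  set x := X l with hxdef
  obtain ⟨B, hB⟩ : ∃ B, B = (1 - x) * (1 - x ^ (d + 1)) / x := ⟨_, rfl⟩
  obtain ⟨c, hc⟩ : ∃ c, c = a l * x / ((1 - x) * (1 - x ^ (d + 1))) := ⟨_, rfl⟩
  let w : MvPowerSeries (Fin d) (LaurentSeries F) := MvPowerSeries.X l
  let f : ℤ → MvPowerSeries (Fin d) (LaurentSeries F) :=
    fun i => 1 - MvPowerSeries.C (c * x ^ i) * w
  let g : ℤ → MvPowerSeries (Fin d) (LaurentSeries F) := fun i => axisGeom l (c * x ^ i)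
  have hfg : ∀ i, f i * g i = 1 := fun i => one_sub_mul_axisGeom l (c * x ^ i)
  -- the closed form of `1 - ρ_i`
  have hρ : ∀ i, 1 - rhoFormal X (axisFamily X a l) i =
      (f (i - 1) * g i) * (f (i + d + 1) * g (i + d)) := by
    intro i
    have hr : rhoFormal X (axisFamily X a l) i = MvPowerSeries.C (B / (1 - x ^ d)) *
        (g i - g (i + d)) := rhoFormal_axisFamily hX a l hB hc i
    have hscal : MvPowerSeries.C (σ := Fin d) (c * x ^ (i - 1)) +
        MvPowerSeries.C (c * x ^ (i + d + 1)) =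
        MvPowerSeries.C (c * x ^ i) + MvPowerSeries.C (c * x ^ (i + d)) +
          MvPowerSeries.C (B / (1 - x ^ d)) *
          (MvPowerSeries.C (c * x ^ i) - MvPowerSeries.C (c * x ^ (i + d))) := by
      rw [← map_add, ← map_add, ← map_sub, ← map_mul, ← map_add]
      congr 1
      rw [hB, zpow_add_one₀ hx0, zpow_add₀ hx0, zpow_natCast, zpow_sub_one₀ hx0]
      field_simp
      ring
    have hsq : MvPowerSeries.C (σ := Fin d) (c * x ^ (i - 1)) *
        MvPowerSeries.C (c * x ^ (i + d + 1)) =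
        MvPowerSeries.C (c * x ^ i) * MvPowerSeries.C (c * x ^ (i + d)) := by
      rw [← map_mul, ← map_mul]
      congr 1
      rw [zpow_add_one₀ hx0, zpow_sub_one₀ hx0]
      field_simp
    have hquad : f (i - 1) * f (i + d + 1) = f i * f (i + d) -
        MvPowerSeries.C (B / (1 - x ^ d)) * (f (i + d) - f i) := by
      simp only [f]
      linear_combination -w * hscal + w ^ 2 * hsq
    rw [hr]
    linear_combination -g i * g (i + d) * hquad +
      (-1 - MvPowerSeries.C (B / (1 - x ^ d)) * g (i + d)) * hfg i +
      (-f i * g i + MvPowerSeries.C (B / (1 - x ^ d)) * g i) * hfg (i + d)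
  have hprod : ∏ k ∈ Icc (-(d : ℤ)) d, (1 - rhoFormal X (axisFamily X a l) (j + k)) =
      (f (j - d - 1) * g (j + d)) * (f (j + 2 * d + 1) * g j) := by
    rw [prod_congr rfl fun k _ => hρ (j + k)]
    exact prod_Icc_telescope hfg d j
  have hcard : #(Icc (-(d : ℤ)) d) = 2 * d + 1 := by simp; omega
  have hT : T F d = 1 + z F d * T F d ^ (2 * d) * T F d := by
    conv_lhs => rw [T_eq, pow_succ, ← mul_assoc]
  have hlin := linear_coeff_identity hx0 hT (hX l).1 j
  have e0 : MvPowerSeries.C (σ := Fin d) (T F d) = 1 + MvPowerSeries.C (z F d) *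
      MvPowerSeries.C (T F d) ^ (2 * d + 1) := by
    conv_lhs => rw [T_eq]
    simp
  have e1 : MvPowerSeries.C (σ := Fin d) (T F d) * (MvPowerSeries.C (c * x ^ (j - 1)) +
      MvPowerSeries.C (c * x ^ (j + d + 1))) =
      MvPowerSeries.C (c * x ^ j) + MvPowerSeries.C (c * x ^ (j + d)) +
      MvPowerSeries.C (z F d) * MvPowerSeries.C (T F d) ^ (2 * d + 1) *
        (MvPowerSeries.C (c * x ^ (j - d - 1)) + MvPowerSeries.C (c * x ^ (j + 2 * d + 1))) := by
    simp only [← map_add, ← map_mul, ← map_pow]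
    congr 1
    linear_combination c * hlin
  have e2 : ∀ i k : ℤ, MvPowerSeries.C (σ := Fin d) (c * x ^ i) * MvPowerSeries.C (c * x ^ k) =
      MvPowerSeries.C (c ^ 2 * x ^ (i + k)) := by
    intro i k
    rw [← map_mul, zpow_add₀ hx0]
    congr 1
    ring
  have e3 := e2 (j - 1) (j + d + 1)
  have e4 := e2 j (j + d)
  have e5 := e2 (j - d - 1) (j + 2 * d + 1)
  rw [show j - 1 + (j + d + 1) = j + (j + d) by ring] at e3
  rw [show j - d - 1 + (j + 2 * d + 1) = j + (j + d) by ring] at e5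
  have hquad : MvPowerSeries.C (T F d) * (f (j - 1) * f (j + d + 1)) = f j * f (j + d) +
      MvPowerSeries.C (z F d) * MvPowerSeries.C (T F d) ^ (2 * d + 1) *
        (f (j - d - 1) * f (j + 2 * d + 1)) := by
    simp only [f]
    linear_combination (1 + w ^ 2 * MvPowerSeries.C (c ^ 2 * x ^ (j + (j + d)))) * e0 - w * e1 +
      w ^ 2 * (MvPowerSeries.C (T F d) * e3 - e4 - MvPowerSeries.C (z F d) *
        MvPowerSeries.C (T F d) ^ (2 * d + 1) * e5)
  unfold TreeEquation
  simp only
  rw [prod_mul_distrib, prod_const, hcard, hprod, hρ]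
  linear_combination g j * g (j + d) * hquad + f (j + d) * g (j + d) * hfg j + hfg (j + d)

/-! ### Existence and uniqueness of the coefficient family -/

/-- The right-hand side of the recurrence relation at `n`. -/
def recurrenceRHS (X : Fin d → LaurentSeries F) (α : (Fin d →₀ ℕ) → LaurentSeries F)
    (n : Fin d →₀ ℕ) : LaurentSeries F :=
  ∑ l ∈ Icc 2 (2 * d + 1), (-1) ^ l *
    ∑ b ∈ powersetCard l (Icc (-(d : ℤ)) d),
      ∑ g ∈ (piAntidiag b n).filter (fun g => ∀ k ∈ b, g k ≠ 0),
        (∏ k ∈ b, α (g k)) * ∏ k ∈ b, monom X k (g k)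

/-- The factor of `α_n` in the recurrence relation. -/
def recurrenceFactor [NeZero d] (X : Fin d → LaurentSeries F) (n : Fin d →₀ ℕ) : LaurentSeries F :=
  -(1 / (z F d * T F d ^ (2 * d))) + ∑ l ∈ Icc (-(d : ℤ)) d, monom X l n

theorem recurrence_iff [NeZero d] {X : Fin d → LaurentSeries F}
    {α : (Fin d →₀ ℕ) → LaurentSeries F} {n : Fin d →₀ ℕ} :
    Recurrence X α n ↔ α n * recurrenceFactor X n = recurrenceRHS X α n := Iff.rfl

theorem degree_lt_of_mem_piAntidiag {σ : Type*} [DecidableEq σ] {b : Finset ℤ} (hb : 2 ≤ #b)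
    {n : σ →₀ ℕ}
    {g : ℤ → σ →₀ ℕ} (hg : g ∈ piAntidiag b n) (hg0 : ∀ k ∈ b, g k ≠ 0) {k : ℤ} (hk : k ∈ b) :
    (g k).degree < n.degree := by
  obtain ⟨k', hk', hne⟩ := exists_mem_ne (by omega : 1 < #b) k
  rw [← (mem_piAntidiag.1 hg).1, map_sum]
  refine single_lt_sum (f := fun k => (g k).degree) hne hk hk' ?_ fun _ _ _ => Nat.zero_le _
  exact Nat.pos_of_ne_zero fun h => hg0 k' hk' ((Finsupp.degree_eq_zero_iff _).1 h)

/-- As the `g_k` are nonzero and at least two in number, only values at indices below `n` of smaller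
degree enter the right-hand side of the recurrence. -/
theorem recurrenceRHS_congr (X : Fin d → LaurentSeries F) {α β : (Fin d →₀ ℕ) → LaurentSeries F}
    {n : Fin d →₀ ℕ} (h : ∀ m ≤ n, m.degree < n.degree → α m = β m) :
    recurrenceRHS X α n = recurrenceRHS X β n := by
  refine sum_congr rfl fun l hl => ?_
  congr 1
  refine sum_congr rfl fun b hb => sum_congr rfl fun g hg => ?_
  rw [mem_filter] at hg
  congr 1
  refine prod_congr rfl fun k hk => h _ ?_ ?_
  · rw [← (mem_piAntidiag.1 hg.1).1]
    exact single_le_sum (f := g) (fun _ _ => zero_le) hk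
  · refine degree_lt_of_mem_piAntidiag ?_ hg.1 hg.2 hk
    rw [(mem_powersetCard.1 hb).2]
    exact (mem_Icc.1 hl).1

theorem valuation_monom [NeZero d] {X : Fin d → LaurentSeries F} (hX : ∀ l, X l ∈ smallRoots F d)
    (j : ℤ) (n : Fin d →₀ ℕ) :
    Valued.v (monom X j n) = WithZero.exp (-(j * n.degree)) := by
  have h : Valued.v (monom X 1 n) = WithZero.exp (-(n.degree : ℤ)) := by
    have hs : ∀ s : Finset (Fin d), Valued.v (∏ l ∈ s, X l ^ (1 * (n l : ℤ))) =
        WithZero.exp (-((∑ l ∈ s, n l : ℕ) : ℤ)) := by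
      intro s
      induction s using Finset.induction_on with
      | empty => simp
      | insert l s hl ih =>
        rw [prod_insert hl, sum_insert hl, map_mul, ih, one_mul, zpow_natCast, map_pow,
          valuation_of_mem_smallRoots (hX l), ← WithZero.exp_nsmul, ← WithZero.exp_add]
        congr 1
        simp
        ring
    rw [monom, hs, Finsupp.degree_eq_sum]
  rw [monom_eq_zpow, map_zpow₀, h, ← WithZero.exp_zsmul]
  simp

/-- If `n` is not on an axis, then `|n| ≥ 2`, so that the term `X ^ (-d n)` dominates. -/
theorem valuation_recurrenceFactor [NeZero d] {X : Fin d → LaurentSeries F}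
    (hX : ∀ l, X l ∈ smallRoots F d) {n : Fin d →₀ ℕ} (hn : 2 ≤ n.degree) :
    Valued.v (recurrenceFactor X n) = WithZero.exp ((d : ℤ) * n.degree) := by
  have hd := NeZero.pos d
  have h0 := monom_ne_zero (fun l => ne_zero_of_mem_smallRoots (hX l)) 1 n
  have hm := valuation_monom hX 1 n
  rw [one_mul] at hm
  have h1 : Valued.v (∑ l ∈ Icc (-(d : ℤ)) d, monom X l n) =
      WithZero.exp ((d : ℤ) * n.degree) := by
    rw [sum_congr rfl fun l _ => monom_eq_zpow l n, valuation_sum_Icc_zpow h0, hm,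
      ← WithZero.exp_nsmul, ← WithZero.exp_neg]
    · simp
    · rw [hm, ← WithZero.exp_zero, WithZero.exp_lt_exp]
      omega
  rw [recurrenceFactor, Valuation.map_add_eq_of_lt_right, h1]
  rw [h1, Valuation.map_neg, one_div, map_inv₀, valuation_z_mul_T_pow, ← WithZero.exp_neg, neg_neg,
    WithZero.exp_lt_exp]
  have : (2 : ℤ) ≤ n.degree := by exact_mod_cast hn
  nlinarith

theorem recurrenceFactor_ne_zero [NeZero d] {X : Fin d → LaurentSeries F}
    (hX : ∀ l, X l ∈ smallRoots F d) {n : Fin d →₀ ℕ} (hn : 2 ≤ n.degree) :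
    recurrenceFactor X n ≠ 0 := by
  rw [← Valuation.ne_zero_iff Valued.v, valuation_recurrenceFactor hX hn]
  simp

theorem two_le_degree [NeZero d] {n : Fin d →₀ ℕ}
    (hn : ∀ (l : Fin d) (k : ℕ), n ≠ Finsupp.single l k) :
    2 ≤ n.degree := by
  by_contra h
  have h0 : n ≠ 0 := by simpa using hn 0 0
  obtain ⟨l, hl⟩ := Finsupp.ne_iff.1 h0
  have hd : n.degree = ∑ i, n i := Finsupp.degree_eq_sum n
  refine hn l (n l) (Finsupp.ext fun i => ?_)
  by_cases hi : i = l
  · rw [hi, Finsupp.single_eq_same]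
  · rw [Finsupp.single_eq_of_ne hi]
    have hle := sum_le_sum_of_subset (f := fun i => n i) (subset_univ {i, l})
    rw [sum_pair hi] at hle
    simp at hl
    omega

/-- Recursion on a degree: `α n` may be prescribed in terms of the values of `α` at indices of
smaller degree. -/
theorem exists_eq_of_lt_degree {ι K : Type*} [Zero K] (deg : ι → ℕ) (Φ : ι → (ι → K) → K) :
    ∃ α : ι → K, ∀ n, α n = Φ n (fun m => if deg m < deg n then α m else 0) := by
  let G : (n : ι) → ((m : ι) → (measure deg).rel m n → K) → K := fun n ih =>
    Φ n (fun m => if h : deg m < deg n then ih m h else 0)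
  refine ⟨(measure deg).wf.fix G, fun n => ?_⟩
  rw [WellFounded.fix_eq]
  simp only [G, dite_eq_ite]

theorem exists_isCoeffFamily [NeZero d] {X : Fin d → LaurentSeries F}
    (hX : ∀ l, X l ∈ smallRoots F d) (a : Fin d → LaurentSeries F) :
    ∃ α, IsCoeffFamily X a α := by
  classical
  obtain ⟨α, hα⟩ := exists_eq_of_lt_degree (Finsupp.degree : (Fin d →₀ ℕ) → ℕ)
    (fun n (β : (Fin d →₀ ℕ) → LaurentSeries F) =>
      if h : ∃ l, n = Finsupp.single l (n l) then axisCoeff d (X h.choose) (a h.choose) (n h.choose)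
      else recurrenceRHS X β n / recurrenceFactor X n)
  refine ⟨α, ?_, ?_, ?_⟩
  · rw [hα, dif_pos ⟨0, by simp⟩]
    exact axisCoeff_zero _ _
  · intro l k hk
    have h : ∃ l', Finsupp.single l k = Finsupp.single l' (Finsupp.single l k l') := ⟨l, by simp⟩
    rw [hα, dif_pos h]
    have hl : l = h.choose := by
      by_contra hne
      have := h.choose_spec
      rw [Finsupp.single_eq_of_ne (Ne.symm hne), Finsupp.single_zero,
        Finsupp.single_eq_zero] at this
      omega
    rw [← hl, Finsupp.single_eq_same]
    rfl
  · intro n hn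
    rw [recurrence_iff, hα, dif_neg (fun ⟨l, hl⟩ => hn l _ hl),
      div_mul_cancel₀ _ (recurrenceFactor_ne_zero hX (two_le_degree hn))]
    exact recurrenceRHS_congr X fun m _ hm => if_pos hm

theorem IsCoeffFamily.single [NeZero d] {X a : Fin d → LaurentSeries F}
    {α : (Fin d →₀ ℕ) → LaurentSeries F} (h : IsCoeffFamily X a α) (l : Fin d) (k : ℕ) :
    α (Finsupp.single l k) = axisCoeff d (X l) (a l) k := by
  rcases k with _ | k
  · rw [Finsupp.single_zero, h.zero, axisCoeff_zero]
  · exact h.axis l (k + 1) (by omega)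

theorem IsCoeffFamily.unique [NeZero d] {X a : Fin d → LaurentSeries F}
    (hX : ∀ l, X l ∈ smallRoots F d) {α β : (Fin d →₀ ℕ) → LaurentSeries F}
    (hα : IsCoeffFamily X a α) (hβ : IsCoeffFamily X a β) : α = β := by
  have key : ∀ N : ℕ, ∀ n : Fin d →₀ ℕ, n.degree = N → α n = β n := by
    intro N
    induction N using Nat.strong_induction_on with
    | _ N ih =>
      rintro n rfl
      by_cases hn : ∃ (l : Fin d) (k : ℕ), n = Finsupp.single l k
      · obtain ⟨l, k, rfl⟩ := hn
        rw [hα.single, hβ.single]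
      · push Not at hn
        refine mul_right_cancel₀ (recurrenceFactor_ne_zero hX (two_le_degree hn)) ?_
        rw [recurrence_iff.1 (hα.off_axis n hn), recurrence_iff.1 (hβ.off_axis n hn)]
        exact recurrenceRHS_congr X fun m _ hm => ih _ hm m rfl
  exact funext fun n => key _ n rfl

theorem isUnit_C_T (F : Type*) [Field F] (d : ℕ) [NeZero d] :
    IsUnit (MvPowerSeries.C (σ := Fin d) (T F d)) :=
  (T_ne_zero F d).isUnit.map _

theorem treeEquation_rhoFormal_iff [NeZero d] {X : Fin d → LaurentSeries F}
    {α : (Fin d →₀ ℕ) → LaurentSeries F} (j : ℤ) :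
    TreeEquation d (MvPowerSeries.C (z F d))
      (fun i => MvPowerSeries.C (T F d) * (1 - rhoFormal X α i)) j ↔
    MainEquation d (MvPowerSeries.C (z F d * T F d ^ (2 * d))) (rhoFormal X α) j := by
  rw [treeEquation_iff_mainEquation (isUnit_C_T F d), map_mul, map_pow]
  conv_lhs => rw [T_eq]
  simp

/-- The recurrence holds at every index; on the axes this is the univariate closed form. -/
theorem IsCoeffFamily.recurrence [NeZero d] {X a : Fin d → LaurentSeries F}
    (hX : ∀ l, X l ∈ smallRoots F d) {α : (Fin d →₀ ℕ) → LaurentSeries F}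
    (hα : IsCoeffFamily X a α) (n : Fin d →₀ ℕ) : Recurrence X α n := by
  by_cases hn : ∃ (l : Fin d) (k : ℕ), n = Finsupp.single l k
  · obtain ⟨l, k, rfl⟩ := hn
    have h0 : axisFamily X a l 0 = 0 := by simpa [axisCoeff_zero] using axisFamily_single X a l 0
    have h := (mainEquation_rhoFormal_iff (fun l => ne_zero_of_mem_smallRoots (hX l))
      (z_mul_T_pow_ne_zero F d) h0 0).1
      ((treeEquation_rhoFormal_iff 0).1 (treeEquation_axisFamily hX a l 0)) (Finsupp.single l k)
    rw [recurrence_iff, axisFamily_single] at h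
    rw [recurrence_iff, hα.single, h]
    refine recurrenceRHS_congr X fun m hm _ => ?_
    have hms : m = Finsupp.single l (m l) := by
      ext i
      by_cases hi : i = l
      · rw [hi, Finsupp.single_eq_same]
      · have := hm i
        rw [Finsupp.single_eq_of_ne hi] at this ⊢
        omega
    rw [hms, hα.single, axisFamily_single]
  · push Not at hn
    exact hα.off_axis n hn

open Filter Topology

/-! ### Convergence -/

theorem exp_sum {ι : Type*} (s : Finset ι) (f : ι → ℤ) :
    WithZero.exp (∑ i ∈ s, f i) = ∏ i ∈ s, WithZero.exp (f i) := by
  classical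
  induction s using Finset.induction_on with
  | empty => simp
  | insert i s hi ih => rw [sum_insert hi, prod_insert hi, WithZero.exp_add, ih]

/-- The elements `k + d` of a shifted subset of `{-d, …, d}` are distinct and nonnegative, so all
but one of them are at least one. -/
theorem card_le_sum_mul_degree {σ : Type*} {b : Finset ℤ} (hb : b ⊆ Icc (-(d : ℤ)) d)
    {g : ℤ → σ →₀ ℕ} (hg : ∀ k ∈ b, g k ≠ 0) :
    (#b : ℤ) - 1 ≤ ∑ k ∈ b, (k + d) * (g k).degree := by
  have hnonneg : ∀ k ∈ b, 0 ≤ (k + d) * ((g k).degree : ℤ) := fun k hk =>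
    mul_nonneg (by have := (mem_Icc.1 (hb hk)).1; omega) (by positivity)
  calc (#b : ℤ) - 1 ≤ #(b.erase (-(d : ℤ))) := by
        have := pred_card_le_card_erase (s := b) (a := -(d : ℤ)); omega
    _ = ∑ k ∈ b.erase (-(d : ℤ)), 1 := by simp
    _ ≤ ∑ k ∈ b.erase (-(d : ℤ)), (k + d) * ((g k).degree : ℤ) := by
        refine sum_le_sum fun k hk => ?_
        rw [mem_erase] at hk
        have h1 := (mem_Icc.1 (hb hk.2)).1
        have h2 : (g k).degree ≠ 0 := fun h => hg k hk.2 ((Finsupp.degree_eq_zero_iff _).1 h)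
        exact one_le_mul_of_one_le_of_one_le (by omega) (by omega)
    _ ≤ _ := sum_le_sum_of_subset_of_nonneg (erase_subset _ _) fun k hk _ => hnonneg k hk

theorem valuation_neg_one_pow_mul (l : ℕ) (x : LaurentSeries F) :
    Valued.v ((-1) ^ l * x) = Valued.v x := by
  rcases neg_one_pow_eq_or (LaurentSeries F) l with h | h <;> simp [h, Valuation.map_neg]

theorem valuation_axisCoeff_le [NeZero d] {x a : LaurentSeries F}
    (hx : Valued.v x = WithZero.exp (-1 : ℤ))
    {j₀ : ℤ} (ha : Valued.v a ≤ WithZero.exp j₀) (k : ℕ) :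
    Valued.v (axisCoeff d x a (k + 1)) ≤ WithZero.exp (j₀ * (k + 1 : ℕ) - (k + 1 : ℕ) + 1) := by
  have hx1 : Valued.v x < 1 := by
    rw [hx, ← WithZero.exp_zero, WithZero.exp_lt_exp]; norm_num
  have h1 := valuation_one_sub_pow hx1 (NeZero.ne d)
  have h2 : Valued.v (1 - x) = 1 := by simpa using valuation_one_sub_pow hx1 one_ne_zero
  have h3 := valuation_one_sub_pow hx1 (Nat.succ_ne_zero d)
  have h4 := valuation_one_sub_pow hx1 (mul_ne_zero (Nat.succ_ne_zero k) (NeZero.ne d))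
  rw [Nat.succ_eq_add_one] at h3 h4
  rw [axisCoeff, Nat.add_sub_cancel]
  simp only [map_div₀, map_mul, map_pow, h1, h2, h3, h4, one_pow, mul_one, div_one, hx]
  calc Valued.v a ^ (k + 1) * WithZero.exp (-1 : ℤ) ^ k
      ≤ WithZero.exp j₀ ^ (k + 1) * WithZero.exp (-1 : ℤ) ^ k := by gcongr
    _ = _ := by
      rw [← WithZero.exp_nsmul, ← WithZero.exp_nsmul, ← WithZero.exp_add]
      congr 1
      simp
      ring

/-- The order of `α_n` is at least `|n| - 1 - j₀ |n|` if every `a_l` has order at least `-j₀`. -/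
theorem IsCoeffFamily.valuation_le [NeZero d] {X a : Fin d → LaurentSeries F}
    (hX : ∀ l, X l ∈ smallRoots F d) {α : (Fin d →₀ ℕ) → LaurentSeries F}
    (hα : IsCoeffFamily X a α) {j₀ : ℤ} (ha : ∀ l, Valued.v (a l) ≤ WithZero.exp j₀)
    {n : Fin d →₀ ℕ} (hn0 : n ≠ 0) :
    Valued.v (α n) ≤ WithZero.exp (j₀ * n.degree - n.degree + 1) := by
  induction hN : n.degree using Nat.strong_induction_on generalizing n with
  | _ N ih =>
    subst hN
    by_cases hn : ∃ (l : Fin d) (k : ℕ), n = Finsupp.single l k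
    · obtain ⟨l, k, rfl⟩ := hn
      rcases k with _ | k
      · simp at hn0
      · rw [hα.single, Finsupp.degree_single]
        exact valuation_axisCoeff_le (valuation_of_mem_smallRoots (hX l)) (ha l) k
    · push Not at hn
      have hrec := congrArg Valued.v (recurrence_iff.1 (hα.off_axis n hn))
      rw [map_mul, valuation_recurrenceFactor hX (two_le_degree hn)] at hrec
      refine le_of_mul_le_mul_right ?_ (WithZero.exp_pos (a := (d : ℤ) * n.degree))
      rw [hrec, ← WithZero.exp_add]
      refine Valuation.map_sum_le _ fun l hl => ?_
      rw [valuation_neg_one_pow_mul]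
      refine Valuation.map_sum_le _ fun b hb => Valuation.map_sum_le _ fun g hg => ?_
      rw [mem_filter] at hg
      rw [mem_powersetCard] at hb
      have hb2 : 2 ≤ #b := by rw [hb.2]; exact (mem_Icc.1 hl).1
      have hdeg : ((∑ k ∈ b, (g k).degree : ℕ) : ℤ) = n.degree := by
        rw [← (mem_piAntidiag.1 hg.1).1, map_sum]
      rw [map_mul, map_prod, map_prod]
      calc (∏ k ∈ b, Valued.v (α (g k))) * ∏ k ∈ b, Valued.v (monom X k (g k))
          ≤ (∏ k ∈ b, WithZero.exp (j₀ * (g k).degree - (g k).degree + 1)) *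
            ∏ k ∈ b, WithZero.exp (-(k * (g k).degree)) := by
            refine mul_le_mul' (prod_le_prod (fun _ _ => zero_le) fun k hk => ?_)
              (prod_le_prod (fun _ _ => zero_le) fun k hk => (valuation_monom hX k _).le)
            exact ih _ (degree_lt_of_mem_piAntidiag hb2 hg.1 hg.2 hk) (hg.2 k hk) rfl
        _ ≤ _ := by
            rw [← exp_sum, ← exp_sum, ← WithZero.exp_add, WithZero.exp_le_exp]
            have h := card_le_sum_mul_degree hb.1 hg.2
            push_cast at hdeg
            simp only [add_mul, sum_add_distrib, ← mul_sum, sum_sub_distrib, sum_neg_distrib,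
              sum_const, hdeg] at h ⊢
            simp at h ⊢
            linarith

instance nonarchimedeanRing_laurentSeries : NonarchimedeanRing (LaurentSeries F) where
  is_nonarchimedean s hs := by
    obtain ⟨γ, hγ⟩ := Valued.mem_nhds_zero.1 hs
    exact ⟨⟨Valued.v.restrict.ltAddSubgroup γ, Valued.isOpen_ball _ γ.1⟩, hγ⟩

theorem tendsto_cofinite_zero_of_finite {ι : Type*} {f : ι → LaurentSeries F}
    (h : ∀ m : ℤ, {i | WithZero.exp m ≤ Valued.v (f i)}.Finite) :
    Tendsto f cofinite (𝓝 0) := by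
  intro s hs
  obtain ⟨γ, hγ⟩ := Valued.mem_nhds_zero.1 hs
  have h0 : MonoidWithZeroHom.ValueGroup₀.embedding γ.1 ≠ 0 := by
    simp
  rw [Filter.mem_map, mem_cofinite]
  refine (h (WithZero.log (MonoidWithZeroHom.ValueGroup₀.embedding γ.1))).subset fun i hi => ?_
  rw [Set.mem_compl_iff, Set.mem_preimage] at hi
  change WithZero.exp (WithZero.log _) ≤ Valued.v (f i)
  rw [WithZero.exp_log h0]
  by_contra hlt
  exact hi (hγ ((Valuation.restrict_lt_iff_lt_embedding _).2 (not_le.1 hlt)))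

theorem summable_of_valuation_le {f : (Fin d →₀ ℕ) → LaurentSeries F}
    (h : ∀ n, Valued.v (f n) ≤ WithZero.exp (1 - (n.degree : ℤ))) : Summable f := by
  refine NonarchimedeanAddGroup.summable_of_tendsto_cofinite_zero
    (tendsto_cofinite_zero_of_finite fun m => ?_)
  refine (Finsupp.finite_of_degree_le (1 - m).toNat).subset fun n hn => ?_
  have := WithZero.exp_le_exp.1 (le_trans hn (h n))
  change n.degree ≤ _
  omega

theorem IsCoeffFamily.summable [NeZero d] {X a : Fin d → LaurentSeries F}
    (hX : ∀ l, X l ∈ smallRoots F d) {α : (Fin d →₀ ℕ) → LaurentSeries F}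
    (hα : IsCoeffFamily X a α) {j₀ : ℤ} (ha : ∀ l, Valued.v (a l * X l ^ j₀) ≤ 1) {j : ℤ}
    (hj : j₀ ≤ j) : Summable (fun n : Fin d →₀ ℕ => α n * monom X j n) := by
  have ha' : ∀ l, Valued.v (a l) ≤ WithZero.exp j₀ := by
    intro l
    have h := ha l
    rw [map_mul, map_zpow₀, valuation_of_mem_smallRoots (hX l), ← WithZero.exp_zsmul] at h
    have h' := mul_le_mul_left h (WithZero.exp j₀)
    rw [mul_assoc, ← WithZero.exp_add] at h'
    simpa using h'
  refine summable_of_valuation_le fun n => ?_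
  by_cases hn : n = 0
  · rw [hn, hα.zero]
    simp
  · rw [map_mul, valuation_monom hX]
    refine (mul_le_mul_left (hα.valuation_le hX ha' hn) _).trans ?_
    rw [← WithZero.exp_add, WithZero.exp_le_exp]
    have : 0 ≤ (j - j₀) * (n.degree : ℤ) := mul_nonneg (by omega) (by positivity)
    linarith

/-! ### Evaluation of formal power series at `w = 1` -/

section Evaluation

variable {K σ : Type*} [CommRing K] [TopologicalSpace K]

theorem hasSum_coeff_C (a : K) :
    HasSum (fun n => MvPowerSeries.coeff n (MvPowerSeries.C (σ := σ) a)) a := by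
  classical
  have h := hasSum_single (f := fun n => MvPowerSeries.coeff n (MvPowerSeries.C (σ := σ) a)) 0
    fun n hn => by rw [MvPowerSeries.coeff_C, if_neg hn]
  simpa using h

theorem hasSum_coeff_sum [ContinuousAdd K] {ι : Type*} {s : Finset ι} {f : ι → MvPowerSeries σ K}
    {a : ι → K} (h : ∀ i ∈ s, HasSum (fun n => MvPowerSeries.coeff n (f i)) (a i)) :
    HasSum (fun n => MvPowerSeries.coeff n (∑ i ∈ s, f i)) (∑ i ∈ s, a i) := by
  simp only [map_sum]
  exact hasSum_sum h

end Evaluation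

section Evaluation

variable {K σ : Type*} [CommRing K] [UniformSpace K] [IsUniformAddGroup K] [NonarchimedeanRing K]

/-- Summing all the coefficients of formal power series is multiplicative. -/
theorem hasSum_coeff_mul {f g : MvPowerSeries σ K} {a b : K}
    (hf : HasSum (fun n => MvPowerSeries.coeff n f) a)
    (hg : HasSum (fun n => MvPowerSeries.coeff n g) b) :
    HasSum (fun n => MvPowerSeries.coeff n (f * g)) (a * b) := by
  classical
  have h := hf.mul_of_nonarchimedean hg
  rw [← Finset.HasAntidiagonal.sigmaAntidiagonalEquivProd.hasSum_iff] at h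
  convert! h.sigma fun n => hasSum_fintype _ using 2 with n
  rw [MvPowerSeries.coeff_mul, ← Finset.sum_coe_sort]
  rfl

theorem hasSum_coeff_prod {ι : Type*} {s : Finset ι} {f : ι → MvPowerSeries σ K} {a : ι → K}
    (h : ∀ i ∈ s, HasSum (fun n => MvPowerSeries.coeff n (f i)) (a i)) :
    HasSum (fun n => MvPowerSeries.coeff n (∏ i ∈ s, f i)) (∏ i ∈ s, a i) := by
  classical
  induction s using Finset.induction_on with
  | empty => simpa using hasSum_coeff_C (σ := σ) (1 : K)
  | insert i s hi ih =>
    rw [prod_insert hi, prod_insert hi]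
    exact hasSum_coeff_mul (h i (mem_insert_self i s))
      (ih fun k hk => h k (mem_insert_of_mem hk))

/-- A formal main equation between power series whose coefficients are summable holds for their
values at `w = 1`. -/
theorem mainEquation_of_hasSum [T2Space K] {Z : K} {ρ : ℤ → MvPowerSeries σ K} {r : ℤ → K} {j : ℤ}
    (h : MainEquation d (MvPowerSeries.C Z) ρ j)
    (hr : ∀ i, j - d ≤ i → HasSum (fun n => MvPowerSeries.coeff n (ρ i)) (r i)) :
    MainEquation d Z r j := by
  refine (hr j (by omega)).unique ?_
  rw [h]
  refine hasSum_coeff_mul (hasSum_coeff_C Z) (hasSum_coeff_sum fun l _ => ?_)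
  have e : ((-1) ^ (l - 1) : MvPowerSeries σ K) = MvPowerSeries.C ((-1) ^ (l - 1)) := by simp
  rw [e]
  refine hasSum_coeff_mul (hasSum_coeff_C _) (hasSum_coeff_sum fun b hb =>
    hasSum_coeff_prod fun k hk => hr _ ?_)
  have := (mem_Icc.1 ((mem_powersetCard.1 hb).1 hk)).1
  omega

end Evaluation

end EmbeddedTrees

end

theorem mainTheorem4 {F : Type*} [Field F] [Algebra ℂ F] (d : ℕ) [NeZero d] :
    -- there are exactly `d` small solutions of the characteristic equation
    (EmbeddedTrees.smallRoots F d).ncard = d ∧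
    -- for any enumeration of them and any initial values `a`
    ∀ X : Fin d → LaurentSeries F, Function.Injective X →
      (∀ l, X l ∈ EmbeddedTrees.smallRoots F d) →
    ∀ a : Fin d → LaurentSeries F,
      -- the coefficients exist and are unique
      ∃ α : (Fin d →₀ ℕ) → LaurentSeries F,
        EmbeddedTrees.IsCoeffFamily X a α ∧
        (∀ β, EmbeddedTrees.IsCoeffFamily X a β → β = α) ∧
        -- the initial values are the prescribed ones, and the recurrence holds at every other
        -- nonzero index, those on the coordinate axes included
        (∀ l, α (Finsupp.single l 1) = a l) ∧
        (∀ n : Fin d →₀ ℕ, n ≠ 0 → (∀ l, n ≠ Finsupp.single l 1) →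
          EmbeddedTrees.Recurrence X α n) ∧
        -- the equations hold as identities of formal power series
        (∀ j : ℤ,
          EmbeddedTrees.TreeEquation d (MvPowerSeries.C (EmbeddedTrees.z F d))
            (fun i => MvPowerSeries.C (EmbeddedTrees.T F d) *
              (1 - EmbeddedTrees.rhoFormal X α i)) j ∧
          EmbeddedTrees.MainEquation d
            (MvPowerSeries.C (EmbeddedTrees.z F d * EmbeddedTrees.T F d ^ (2 * d)))
            (EmbeddedTrees.rhoFormal X α) j) ∧
        -- the series `ρ_j` converge `t`-adically where the initial values permit it, and
        -- the equations hold for their sums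
        (∀ j₀ : ℤ, (∀ l, Valued.v (a l * X l ^ j₀) ≤ 1) →
          (∀ j : ℤ, j₀ ≤ j →
            Summable (fun n : Fin d →₀ ℕ => α n * EmbeddedTrees.monom X j n)) ∧
          (∀ j : ℤ, j₀ + d ≤ j →
            EmbeddedTrees.TreeEquation d (EmbeddedTrees.z F d)
              (fun i => EmbeddedTrees.T F d * (1 - EmbeddedTrees.rho X α i)) j ∧
            EmbeddedTrees.MainEquation d
              (EmbeddedTrees.z F d * EmbeddedTrees.T F d ^ (2 * d))
              (EmbeddedTrees.rho X α) j)) := by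
  open EmbeddedTrees in
  refine ⟨ncard_smallRoots, fun X _ hX a => ?_⟩
  obtain ⟨α, hα⟩ := exists_isCoeffFamily hX a
  have hmain : ∀ j, MainEquation d (MvPowerSeries.C (z F d * T F d ^ (2 * d))) (rhoFormal X α) j :=
    fun j => (mainEquation_rhoFormal_iff (fun l => ne_zero_of_mem_smallRoots (hX l))
      (z_mul_T_pow_ne_zero F d) hα.zero j).2 (hα.recurrence hX)
  refine ⟨α, hα, fun β hβ => hβ.unique hX hα, fun l => ?_, fun n _ _ => hα.recurrence hX n,
    fun j => ⟨(treeEquation_rhoFormal_iff j).2 (hmain j), hmain j⟩,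
    fun j₀ ha => ⟨fun j hj => hα.summable hX ha hj, fun j hj => ?_⟩⟩
  · rw [hα.single, axisCoeff_one (hX l).2]
  · have h : MainEquation d (z F d * T F d ^ (2 * d)) (rho X α) j :=
      mainEquation_of_hasSum (hmain j) fun i hi => (hα.summable hX ha (by omega)).hasSum
    exact ⟨(treeEquation_iff_mainEquation (T_ne_zero F d).isUnit (T_eq F d) _ j).2 h, h⟩
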